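/- Let $\Gamma=(X,R)$ be a bipartite distance-regular graph with diameter $D\ge 4$, valency $k\ge 3$, path-length distance $\partial$, and intersection numbers $p^h_{ij}=|\{z\in X:\partial(y,z)=i,\ \partial(z,w)=j\}|$ ($\partial(y,w)=h$), $b_i=p^i_{1,i+1}$. Let $A$ be the adjacency matrix of $\Gamma$, let $A_2$ be its second distance matrix (with $(y,z)$ entry $1$ if $\partial(y,z)=2$ and $0$ otherwise), let $\theta_0>\theta_1>\cdots>\theta_D$ be the distinct eigenvalues of $A$, let $M\subseteq \mathrm{Mat}_X(\mathbb C)$ be the algebra generated by $A$, and put $d=\lfloor D/2\rfloor$. Let $V=\mathbb C^X$ with the Hermitian inner product $\langle u,v\rangle=u^t\overline v$. Fix $x\in X$. For $0\le i\le D$ let $E_i^*$ be the diagonal matrix with $(y,y)$ entry $1$ if $\partial(x,y)=i$ and $0$ otherwise, and let $T\subseteq \mathrm{Mat}_X(\mathbb C)$ be the algebra generated by $A,E_0^*,\dots,E_D^*$. A $T$-module is a subspace $W\subseteq V$ with $TW\subseteq W$; it is irreducible if $W\ne0$ and $W$ contains no $T$-modules other than $0$ and $W$. An irreducible $T$-module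 $W$ is thin if $\dim E_i^*W\le 1$ for $0\le i\le D$; its endpoint is $\min\{i: 0\le i\le D,\ E_i^*W\neq 0\}$. A thin irreducible $T$-module $W$ with endpoint $2$ has local eigenvalue $\eta$ if the one-dimensional space $E_2^*W$ consists of vectors $w$ with $E_2^*A_2E_2^*w=\eta w$. Let $V_0$ be the unique irreducible $T$-module with endpoint $0$, let $Y$ be the span of all irreducible $T$-modules with endpoint $1$, and let $U$ be the orthogonal complement of $E_2^*V_0+E_2^*Y$ in $E_2^*V$. For $\eta\in\mathbb R$ let $U_\eta=\{u\in U: E_2^*A_2E_2^*u=\eta u\}$. **Theorem.** Let $n\in\{1,d\}$ if $D$ is odd, and let $n=1$ if $D$ is even. Then $\theta_n^2\neq b_2$, so that $$\eta=\tilde\theta_n=-1-\frac{b_2b_3}{\theta_n^2-b_2}$$ is a well-defined real number, and for every nonzero $v\in U_\eta$ the space $Mv=\{Bv: B\in M\}$ is a thin irreducible $T$-module with endpoint $2$ and local eigenvalue $\eta$. -/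

import Mathlib

noncomputable section

namespace DRG

/-- `Γ` is a distance-regular graph of diameter `D` with intersection numbers
`p h i j` (written $p^h_{ij}$), for `0 ≤ h, i, j ≤ D`.
The values of `p` outside this range carry no meaning. -/
structure IsDistanceRegularWith {X : Type*} [Fintype X]
    (Γ : SimpleGraph X) (D : ℕ) (p : ℕ → ℕ → ℕ → ℕ) : Prop where
  connected : Γ.Connected
  diam_eq : Γ.diam = D
  card_eq : ∀ h i j : ℕ, h ≤ D → i ≤ D → j ≤ D → ∀ x y : X, Γ.dist x y = h →
    (Finset.univ.filter fun z : X => Γ.dist x z = i ∧ Γ.dist z y = j).card = p h i j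

/-- The intersection number $b_i = p^i_{1,i+1}$. -/
def bNum (p : ℕ → ℕ → ℕ → ℕ) (i : ℕ) : ℕ := p i 1 (i + 1)

/-- The `i`-th distance matrix $A_i$. -/
def distMatrix {X : Type*} (Γ : SimpleGraph X) (i : ℕ) : Matrix X X ℂ :=
  Matrix.of fun y z => if Γ.dist y z = i then 1 else 0

/-- The Bose-Mesner algebra `M`: the algebra generated by the adjacency matrix. -/
def boseMesner {X : Type*} [Fintype X] [DecidableEq X] (Γ : SimpleGraph X)
    [DecidableRel Γ.Adj] : Subalgebra ℂ (Matrix X X ℂ) :=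
  Algebra.adjoin ℂ {Γ.adjMatrix ℂ}

/-- The set of real numbers that are eigenvalues of the adjacency matrix is finite. -/
theorem finite_eigenvalues {X : Type*} [Fintype X] [DecidableEq X] (Γ : SimpleGraph X)
    [DecidableRel Γ.Adj] :
    {t : ℝ | Module.End.HasEigenvalue (Matrix.toLin' (Γ.adjMatrix ℂ)) (t : ℂ)}.Finite :=
  (Module.End.finite_hasEigenvalue (Matrix.toLin' (Γ.adjMatrix ℂ))).preimage
    Complex.ofReal_injective.injOn

/-- The distinct eigenvalues of `Γ`, in decreasing order:
`eigenvalue Γ i` is $θ_i$, where $θ_0 > θ_1 > \cdots$ (and 0 past the end of the list).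
All eigenvalues are real, since the adjacency matrix is real symmetric. -/
def eigenvalue {X : Type*} [Fintype X] [DecidableEq X] (Γ : SimpleGraph X)
    [DecidableRel Γ.Adj] (i : ℕ) : ℝ :=
  ((finite_eigenvalues Γ).toFinset.sort (fun a b => b ≤ a)).getD i 0

/-- The dual idempotent $E_i^* = E_i^*(x)$. -/
def dualIdem {X : Type*} [DecidableEq X] (Γ : SimpleGraph X) (x : X) (i : ℕ) :
    Matrix X X ℂ :=
  Matrix.diagonal fun y => if Γ.dist x y = i then 1 else 0

/-- The dual Bose-Mesner algebra $M^* = M^*(x)$. -/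
def dualBoseMesner {X : Type*} [Fintype X] [DecidableEq X] (Γ : SimpleGraph X) (x : X) :
    Subalgebra ℂ (Matrix X X ℂ) :=
  Algebra.adjoin ℂ (Set.range (dualIdem Γ x))

/-- The subconstituent (Terwilliger) algebra `T = T(x)`, generated by $M$ and $M^*$. -/
def terwilliger {X : Type*} [Fintype X] [DecidableEq X] (Γ : SimpleGraph X)
    [DecidableRel Γ.Adj] (x : X) : Subalgebra ℂ (Matrix X X ℂ) :=
  boseMesner Γ ⊔ dualBoseMesner Γ x

/-- A `T`-module: a subspace of the standard module `ℂ^X` invariant under `T`. -/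
def IsTModule {X : Type*} [Fintype X] [DecidableEq X] (Γ : SimpleGraph X)
    [DecidableRel Γ.Adj] (x : X) (W : Submodule ℂ (X → ℂ)) : Prop :=
  ∀ B ∈ terwilliger Γ x, ∀ w ∈ W, B.mulVec w ∈ W

/-- An irreducible `T`-module. -/
def IsIrreducibleTModule {X : Type*} [Fintype X] [DecidableEq X] (Γ : SimpleGraph X)
    [DecidableRel Γ.Adj] (x : X) (W : Submodule ℂ (X → ℂ)) : Prop :=
  IsTModule Γ x W ∧ W ≠ ⊥ ∧
    ∀ W' : Submodule ℂ (X → ℂ), W' ≤ W → IsTModule Γ x W' → W' = ⊥ ∨ W' = W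

/-- The subspace $E_i^* W$. -/
def dualPart {X : Type*} [Fintype X] [DecidableEq X] (Γ : SimpleGraph X) (x : X) (i : ℕ)
    (W : Submodule ℂ (X → ℂ)) : Submodule ℂ (X → ℂ) :=
  W.map (Matrix.mulVecLin (dualIdem Γ x i))

/-- `W` has endpoint `r`: `r` is the minimum of the `i`, `0 ≤ i ≤ D`, with $E_i^* W ≠ 0$. -/
def HasEndpoint {X : Type*} [Fintype X] [DecidableEq X] (Γ : SimpleGraph X) (x : X)
    (W : Submodule ℂ (X → ℂ)) (r : ℕ) : Prop :=
  IsLeast {i : ℕ | i ≤ Γ.diam ∧ dualPart Γ x i W ≠ ⊥} r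

/-- `W` is thin: $\dim E_i^* W ≤ 1$ for `0 ≤ i ≤ D`. -/
def IsThin {X : Type*} [Fintype X] [DecidableEq X] (Γ : SimpleGraph X) (x : X)
    (W : Submodule ℂ (X → ℂ)) : Prop :=
  ∀ i ≤ Γ.diam, Module.finrank ℂ (dualPart Γ x i W) ≤ 1

/-- The matrix $E_2^* A_2 E_2^*$. -/
def localMatrix {X : Type*} [Fintype X] [DecidableEq X] (Γ : SimpleGraph X) (x : X) :
    Matrix X X ℂ :=
  dualIdem Γ x 2 * distMatrix Γ 2 * dualIdem Γ x 2

/-- `W` has local eigenvalue `η`: $E_2^* W$ is one-dimensional and consists of eigenvectors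
of $E_2^* A_2 E_2^*$ for `η` (and the zero vector). -/
def HasLocalEigenvalue {X : Type*} [Fintype X] [DecidableEq X] (Γ : SimpleGraph X) (x : X)
    (W : Submodule ℂ (X → ℂ)) (η : ℝ) : Prop :=
  Module.finrank ℂ (dualPart Γ x 2 W) = 1 ∧
    ∀ w ∈ dualPart Γ x 2 W, (localMatrix Γ x).mulVec w = (η : ℂ) • w

/-- The span of all irreducible `T`-modules with endpoint `r`. For `r = 0` this is the unique
irreducible `T`-module $V_0$ with endpoint 0, for `r = 1` it is the space $Y$. -/
def endpointSpan {X : Type*} [Fintype X] [DecidableEq X] (Γ : SimpleGraph X)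
    [DecidableRel Γ.Adj] (x : X) (r : ℕ) : Submodule ℂ (X → ℂ) :=
  sSup {W | IsIrreducibleTModule Γ x W ∧ HasEndpoint Γ x W r}

/-- The space `U`: the orthogonal complement of $E_2^* V_0 + E_2^* Y$ in $E_2^* V$, with respect
to the Hermitian form $\langle w, u\rangle = w^t \overline{u}$. -/
def spaceU {X : Type*} [Fintype X] [DecidableEq X] (Γ : SimpleGraph X)
    [DecidableRel Γ.Adj] (x : X) : Submodule ℂ (X → ℂ) where
  carrier := {u | u ∈ dualPart Γ x 2 ⊤ ∧
    ∀ w ∈ dualPart Γ x 2 (endpointSpan Γ x 0) ⊔ dualPart Γ x 2 (endpointSpan Γ x 1),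
      w ⬝ᵥ star u = 0}
  add_mem' := by
    rintro a b ⟨ha, ha'⟩ ⟨hb, hb'⟩
    refine ⟨Submodule.add_mem _ ha hb, fun w hw => ?_⟩
    rw [star_add, dotProduct_add, ha' w hw, hb' w hw, add_zero]
  zero_mem' := ⟨Submodule.zero_mem _, fun w _ => by simp⟩
  smul_mem' := by
    rintro c a ⟨ha, ha'⟩
    refine ⟨Submodule.smul_mem _ c ha, fun w hw => ?_⟩
    rw [star_smul, dotProduct_smul, ha' w hw, smul_zero]

/-- The space $U_η$: the vectors `u` in `U` with $E_2^* A_2 E_2^* u = η u$. -/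
def spaceUEta {X : Type*} [Fintype X] [DecidableEq X] (Γ : SimpleGraph X)
    [DecidableRel Γ.Adj] (x : X) (η : ℝ) : Submodule ℂ (X → ℂ) :=
  spaceU Γ x ⊓ Module.End.eigenspace (Matrix.toLin' (localMatrix Γ x)) (η : ℂ)

/-- The space `Mv = {Bv | B ∈ M}`. -/
def boseMesnerOrbit {X : Type*} [Fintype X] [DecidableEq X] (Γ : SimpleGraph X)
    [DecidableRel Γ.Adj] (v : X → ℂ) : Submodule ℂ (X → ℂ) where
  carrier := {w | ∃ B ∈ boseMesner Γ, B.mulVec v = w}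
  add_mem' := by
    rintro _ _ ⟨B, hB, rfl⟩ ⟨C, hC, rfl⟩
    exact ⟨B + C, add_mem hB hC, Matrix.add_mulVec B C v⟩
  zero_mem' := ⟨0, zero_mem _, Matrix.zero_mulVec v⟩
  smul_mem' := by
    rintro c _ ⟨B, hB, rfl⟩
    exact ⟨c • B, Subalgebra.smul_mem _ hB c, Matrix.smul_mulVec c B v⟩

/-- The scalar $\tilde z = -1 - b_2 b_3 (z^2 - b_2)^{-1}$ for real `z` with `z ^ 2 ≠ b₂`. -/
def tilde (p : ℕ → ℕ → ℕ → ℕ) (z : ℝ) : ℝ :=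
  -1 - (bNum p 2 : ℝ) * (bNum p 3 : ℝ) / (z ^ 2 - (bNum p 2 : ℝ))

end DRG

end

/-! Every matrix in M has entries depending only on distance. A vector v of U lives on the vertices
at distance 2 from x, so by parity and the triangle inequality, for y at distance i from x and B in
M, the entry (Bv)(y) is a combination of the three numbers (A_j v)(y), j = i-2, i, i+2, whose
coefficients depend only on B and i. The whole proof consists of finding two independent linear
relations among these three functions on each subconstituent, which leaves at most one dimension for
E_i^* M v.

The first relation is that they add up to zero, since the entries of v have sum zero. The second
comes from Ev = 0, where E is, up to a scalar, the primitive idempotent of θ = θ_n with entries e_h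
at distance h. Indeed E_2^* E v is a multiple of v with factor e_0 + η e_2 - (1+η) e_4, and η = -1 -
b_2 b_3/(θ² - b_2) is exactly the value making this vanish (`IsCosineSeq.local_relation`). So ⟨v,
Ev⟩ = 0, and then Ev = 0 because E is Hermitian and E² is a multiple of E
(`IsLocalVec.cosine_mulVec_eq_zero`). The relations are independent unless e_{i-2} = e_i = e_{i+2},
which the recurrence excludes when θ ≠ 0 and θ² ≠ k² (`IsCosineSeq.not_eq_three`).

Once all E_i^* M v have dimension at most one and those with i < 2 vanish, M v is closed under the
E_i^* (`isTModule_boseMesnerOrbit`). It is irreducible since v generates it and spans its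
E_2^*-part.

That θ_n² ≠ b_2 follows from tr (A² - b_2)(k² - A²) = 0: if θ_n² = b_2, all eigenvalue contributions
have the same sign, so all vanish, and at most four distinct eigenvalues remain, against D + 1 ≥ 5.
-/

noncomputable section

namespace DRG

set_option linter.unusedSectionVars false

/-! ### Intersection numbers, and the Bose-Mesner algebra as functions of distance -/

section

variable {X : Type*} {Γ : SimpleGraph X} {D k : ℕ} {p : ℕ → ℕ → ℕ → ℕ}

/-- The intersection number $c_h = p^h_{1,h-1}$, with $c_0 = 0$. -/
def downNum (p : ℕ → ℕ → ℕ → ℕ) (h : ℕ) : ℕ := if h = 0 then 0 else p h 1 (h - 1)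

/-- The intersection number $b_h$, with $b_h = 0$ for `h ≥ D`. -/
def upNum (D : ℕ) (p : ℕ → ℕ → ℕ → ℕ) (h : ℕ) : ℕ := if h < D then bNum p h else 0

/-- The action of the adjacency matrix on functions of the distance. -/
def tridiag (D : ℕ) (p : ℕ → ℕ → ℕ → ℕ) (u : ℕ → ℂ) (h : ℕ) : ℂ :=
  downNum p h * u (h - 1) + upNum D p h * u (h + 1)

/-- The matrix whose entries are a given function of the distance. -/
def distFun (Γ : SimpleGraph X) (u : ℕ → ℂ) : Matrix X X ℂ :=
  Matrix.of fun y z => u (Γ.dist y z)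

@[simp] theorem distFun_apply (u : ℕ → ℂ) (y z : X) : distFun Γ u y z = u (Γ.dist y z) := rfl

/-- Geodesics: a vertex at positive distance `h + 1` from `z` has a neighbour at distance `h`. -/
theorem exists_adj_dist_eq (hc : Γ.Connected) {y z : X} {h : ℕ} (hd : Γ.dist y z = h + 1) :
    ∃ w, Γ.Adj y w ∧ Γ.dist w z = h := by
  obtain ⟨q, hq⟩ := hc.exists_walk_length_eq_dist y z
  cases q with
  | nil => simp at hd
  | @cons _ w _ hw q =>
    refine ⟨w, hw, ?_⟩
    have h1 := SimpleGraph.dist_le q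
    have h2 := hc.dist_triangle (u := y) (v := w) (w := z)
    rw [SimpleGraph.dist_eq_one_iff_adj.mpr hw] at h2
    simp only [SimpleGraph.Walk.length_cons] at hq
    omega

theorem even_dist_iff (hc : Γ.Connected) (C : Γ.Coloring Bool) (y z : X) :
    Even (Γ.dist y z) ↔ (C y ↔ C z) := by
  obtain ⟨q, hq⟩ := hc.exists_walk_length_eq_dist y z
  rw [← hq]
  exact C.even_length_iff_congr q

theorem exists_coloring_bool (hbip : Γ.IsBipartite) : Nonempty (Γ.Coloring Bool) :=
  ⟨(hbip : Γ.Colorable 2).toColoring (by simp)⟩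

/-- In a bipartite graph the distances between three vertices have even sum. -/
theorem even_dist_add (hc : Γ.Connected) (hbip : Γ.IsBipartite) (x y z : X) :
    Even (Γ.dist x y + Γ.dist y z + Γ.dist x z) := by
  obtain ⟨C⟩ := exists_coloring_bool hbip
  have h1 := even_dist_iff hc C x y
  have h2 := even_dist_iff hc C y z
  have h3 := even_dist_iff hc C x z
  rw [Nat.even_add, Nat.even_add, h1, h2, h3]
  cases C x <;> cases C y <;> cases C z <;> simp

/-- Adjacent vertices have distances to z differing by at most 1, and parity forbids equality. -/
theorem dist_of_adj (hc : Γ.Connected) (hbip : Γ.IsBipartite) {y w : X} (z : X)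
    (hw : Γ.Adj y w) : Γ.dist w z + 1 = Γ.dist y z ∨ Γ.dist w z = Γ.dist y z + 1 := by
  have h1 := SimpleGraph.dist_eq_one_iff_adj.mpr hw
  have h2 := hc.dist_triangle (u := y) (v := w) (w := z)
  have h3 := hc.dist_triangle (u := w) (v := y) (w := z)
  rw [Γ.dist_comm (u := w) (v := y)] at h3
  have h4 := even_dist_add hc hbip y w z
  rw [Nat.even_iff] at h4
  omega

variable [Fintype X]

theorem IsDistanceRegularWith.dist_le (hΓ : IsDistanceRegularWith Γ D p) (y z : X) :
    Γ.dist y z ≤ D := by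
  have := hΓ.connected.nonempty
  rw [← hΓ.diam_eq]
  exact SimpleGraph.dist_le_diam (SimpleGraph.connected_iff_ediam_ne_top.mp hΓ.connected)

theorem IsDistanceRegularWith.exists_dist_eq (hΓ : IsDistanceRegularWith Γ D p) {h : ℕ}
    (hh : h ≤ D) : ∃ y z : X, Γ.dist y z = h := by
  induction hh using Nat.decreasingInduction with
  | self =>
    have := hΓ.connected.nonempty
    obtain ⟨y, z, hyz⟩ := Γ.exists_dist_eq_diam
    exact ⟨y, z, hyz.trans hΓ.diam_eq⟩
  | of_succ h _ ih =>
    obtain ⟨y, z, hyz⟩ := ih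
    obtain ⟨w, -, hw⟩ := exists_adj_dist_eq hΓ.connected hyz
    exact ⟨w, z, hw⟩

theorem IsDistanceRegularWith.card_down (hΓ : IsDistanceRegularWith Γ D p) (hD : 1 ≤ D)
    (y z : X) [DecidablePred fun w => Γ.Adj y w ∧ Γ.dist w z + 1 = Γ.dist y z] :
    (Finset.univ.filter fun w => Γ.Adj y w ∧ Γ.dist w z + 1 = Γ.dist y z).card =
      downNum p (Γ.dist y z) := by
  unfold downNum
  split_ifs with h
  · simp [h]
  · have h1 := hΓ.dist_le y z
    rw [← hΓ.card_eq (Γ.dist y z) 1 (Γ.dist y z - 1) h1 hD (by omega) y z rfl]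
    congr 1
    ext w
    simp only [Finset.mem_filter, Finset.mem_univ, true_and, SimpleGraph.dist_eq_one_iff_adj]
    refine and_congr_right fun _ => ?_
    omega

theorem IsDistanceRegularWith.card_up (hΓ : IsDistanceRegularWith Γ D p) (hD : 1 ≤ D)
    (y z : X) [DecidablePred fun w => Γ.Adj y w ∧ Γ.dist w z = Γ.dist y z + 1] :
    (Finset.univ.filter fun w => Γ.Adj y w ∧ Γ.dist w z = Γ.dist y z + 1).card =
      upNum D p (Γ.dist y z) := by
  have h1 := hΓ.dist_le y z
  unfold upNum
  split_ifs with h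
  · rw [bNum, ← hΓ.card_eq (Γ.dist y z) 1 (Γ.dist y z + 1) h1 hD (by omega) y z rfl]
    congr 1
    ext w
    simp only [Finset.mem_filter, Finset.mem_univ, true_and, SimpleGraph.dist_eq_one_iff_adj]
  · rw [Finset.card_eq_zero, Finset.filter_eq_empty_iff]
    rintro w - ⟨-, hw⟩
    have := hΓ.dist_le w z
    omega

theorem IsDistanceRegularWith.upNum_pos (hΓ : IsDistanceRegularWith Γ D p) {h : ℕ}
    (hh : h < D) : 0 < upNum D p h := by
  classical
  obtain ⟨y, z, hyz⟩ := hΓ.exists_dist_eq (h := h + 1) hh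
  obtain ⟨w, hw, hwz⟩ := exists_adj_dist_eq hΓ.connected hyz
  rw [← hwz, ← hΓ.card_up (by omega), Finset.card_pos]
  exact ⟨y, by simp [hw.symm, hyz, hwz]⟩

theorem IsDistanceRegularWith.downNum_pos (hΓ : IsDistanceRegularWith Γ D p) {h : ℕ}
    (hh : h + 1 ≤ D) : 0 < downNum p (h + 1) := by
  classical
  obtain ⟨y, z, hyz⟩ := hΓ.exists_dist_eq hh
  obtain ⟨w, hw, hwz⟩ := exists_adj_dist_eq hΓ.connected hyz
  rw [← hyz, ← hΓ.card_down (by omega), Finset.card_pos]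
  exact ⟨w, by simp [hw, hyz, hwz]⟩

theorem IsDistanceRegularWith.downNum_one (hΓ : IsDistanceRegularWith Γ D p) (hD : 1 ≤ D) :
    downNum p 1 = 1 := by
  classical
  obtain ⟨y, z, hyz⟩ := hΓ.exists_dist_eq hD
  rw [← hyz, ← hΓ.card_down hD, hyz, Finset.card_eq_one]
  refine ⟨z, ?_⟩
  ext w
  simp only [Finset.mem_filter, Finset.mem_univ, true_and, Finset.mem_singleton,
    Nat.add_eq_right, hΓ.connected.dist_eq_zero_iff]
  constructor
  · exact fun h => h.2
  · rintro rfl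
    exact ⟨SimpleGraph.dist_eq_one_iff_adj.mp hyz, rfl⟩

theorem IsDistanceRegularWith.one_eq_distFun [DecidableEq X] (hΓ : IsDistanceRegularWith Γ D p) :
    (1 : Matrix X X ℂ) = distFun Γ (Pi.single 0 1) := by
  ext y z
  simp [Matrix.one_apply, Pi.single_apply, hΓ.connected.dist_eq_zero_iff]

section Adj
variable [DecidableRel Γ.Adj]

theorem IsDistanceRegularWith.sum_neighbors (hΓ : IsDistanceRegularWith Γ D p)
    (hbip : Γ.IsBipartite) (hD : 1 ≤ D) (u : ℕ → ℂ) (y z : X) :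
    ∑ w ∈ Γ.neighborFinset y, u (Γ.dist w z) = tridiag D p u (Γ.dist y z) := by
  classical
  have hsplit : Γ.neighborFinset y =
      (Finset.univ.filter fun w => Γ.Adj y w ∧ Γ.dist w z + 1 = Γ.dist y z) ∪
      (Finset.univ.filter fun w => Γ.Adj y w ∧ Γ.dist w z = Γ.dist y z + 1) := by
    ext w
    simp only [SimpleGraph.mem_neighborFinset, Finset.mem_union, Finset.mem_filter,
      Finset.mem_univ, true_and, ← and_or_left]
    exact ⟨fun h => ⟨h, dist_of_adj hΓ.connected hbip z h⟩, fun h => h.1⟩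
  rw [hsplit, Finset.sum_union, tridiag, ← hΓ.card_down hD, ← hΓ.card_up hD]
  · congr 1
    · rw [← nsmul_eq_mul]
      refine Finset.sum_eq_card_nsmul fun w hw => ?_
      simp only [Finset.mem_filter, Finset.mem_univ, true_and] at hw
      rw [← hw.2, Nat.add_sub_cancel]
    · rw [← nsmul_eq_mul]
      refine Finset.sum_eq_card_nsmul fun w hw => ?_
      simp only [Finset.mem_filter, Finset.mem_univ, true_and] at hw
      rw [← hw.2]
  · rw [Finset.disjoint_filter]
    rintro w - h1 h2
    omega

theorem IsDistanceRegularWith.downNum_add_upNum (hΓ : IsDistanceRegularWith Γ D p)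
    (hbip : Γ.IsBipartite) (hD : 1 ≤ D) (hreg : Γ.IsRegularOfDegree k) {h : ℕ} (hh : h ≤ D) :
    downNum p h + upNum D p h = k := by
  obtain ⟨y, z, rfl⟩ := hΓ.exists_dist_eq hh
  have := hΓ.sum_neighbors hbip hD (fun _ => 1) y z
  simp only [Finset.sum_const, nsmul_eq_mul, mul_one, tridiag, SimpleGraph.card_neighborFinset_eq_degree,
    hreg.degree_eq y] at this
  exact_mod_cast this.symm

theorem IsDistanceRegularWith.adj_mul_distFun (hΓ : IsDistanceRegularWith Γ D p)
    (hbip : Γ.IsBipartite) (hD : 1 ≤ D) (u : ℕ → ℂ) :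
    Γ.adjMatrix ℂ * distFun Γ u = distFun Γ (tridiag D p u) := by
  ext y z
  rw [SimpleGraph.adjMatrix_mul_apply, distFun_apply, ← hΓ.sum_neighbors hbip hD]
  rfl

variable [DecidableEq X]

theorem IsDistanceRegularWith.pow_eq_distFun (hΓ : IsDistanceRegularWith Γ D p)
    (hbip : Γ.IsBipartite) (hD : 1 ≤ D) (m : ℕ) :
    Γ.adjMatrix ℂ ^ m = distFun Γ ((tridiag D p)^[m] (Pi.single 0 1)) := by
  induction m with
  | zero => simpa using hΓ.one_eq_distFun
  | succ m ih =>
    rw [pow_succ', ih, hΓ.adj_mul_distFun hbip hD, Function.iterate_succ_apply']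

theorem IsDistanceRegularWith.exists_aeval_eq_distFun (hΓ : IsDistanceRegularWith Γ D p)
    (hbip : Γ.IsBipartite) (hD : 1 ≤ D) (q : Polynomial ℂ) :
    ∃ u, Polynomial.aeval (Γ.adjMatrix ℂ) q = distFun Γ u := by
  induction q using Polynomial.induction_on' with
  | add q r hq hr =>
    obtain ⟨u, hu⟩ := hq
    obtain ⟨u', hu'⟩ := hr
    exact ⟨u + u', by rw [map_add, hu, hu']; ext; simp⟩
  | monomial m a =>
    refine ⟨a • (tridiag D p)^[m] (Pi.single 0 1), ?_⟩
    rw [Polynomial.aeval_monomial, hΓ.pow_eq_distFun hbip hD, ← Algebra.smul_def]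
    ext; simp

theorem mem_boseMesner_iff {B : Matrix X X ℂ} :
    B ∈ boseMesner Γ ↔ ∃ q : Polynomial ℂ, Polynomial.aeval (Γ.adjMatrix ℂ) q = B := by
  rw [boseMesner, Algebra.adjoin_singleton_eq_range_aeval]
  rfl

end Adj

theorem tridiag_iterate_of_lt (m h : ℕ) (hmh : m < h) :
    (tridiag D p)^[m] (Pi.single 0 1) h = 0 := by
  induction m generalizing h with
  | zero => simp [hmh.ne']
  | succ m ih =>
    rw [Function.iterate_succ_apply', tridiag, ih (h - 1) (by omega), ih (h + 1) (by omega)]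
    simp

/-- At distance m the only walks of length m are geodesics, so the value is the product of the
nonzero numbers c_1, ..., c_m. -/
theorem IsDistanceRegularWith.tridiag_iterate_self (hΓ : IsDistanceRegularWith Γ D p) (m : ℕ)
    (hm : m ≤ D) : (tridiag D p)^[m] (Pi.single 0 1) m ≠ 0 := by
  induction m with
  | zero => simp
  | succ m ih =>
    rw [Function.iterate_succ_apply', tridiag, tridiag_iterate_of_lt m (m + 1 + 1) (by omega)]
    simp only [Nat.add_sub_cancel, mul_zero, add_zero]
    exact mul_ne_zero (by exact_mod_cast (hΓ.downNum_pos hm).ne') (ih (by omega))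

end

section

/-! ### Finite sets of reals in decreasing order -/

section SortedList

/-- The `i`-th largest element of a finite set of reals. -/
def nthLargest (S : Finset ℝ) (i : ℕ) : ℝ := (S.sort fun a b => b ≤ a).getD i 0

theorem nthLargest_eq_getElem (S : Finset ℝ) {i : ℕ} (hi : i < S.card) :
    nthLargest S i = (S.sort fun a b => b ≤ a)[i]'(by rwa [Finset.length_sort]) := by
  rw [nthLargest, List.getD_eq_getElem]

theorem nthLargest_mem (S : Finset ℝ) {i : ℕ} (hi : i < S.card) : nthLargest S i ∈ S := by
  rw [nthLargest_eq_getElem S hi, ← Finset.mem_sort fun a b : ℝ => b ≤ a]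
  exact List.getElem_mem _

theorem exists_nthLargest_eq (S : Finset ℝ) {t : ℝ} (ht : t ∈ S) :
    ∃ i < S.card, nthLargest S i = t := by
  rw [← Finset.mem_sort fun a b : ℝ => b ≤ a] at ht
  obtain ⟨i, hi, h⟩ := List.getElem_of_mem ht
  rw [Finset.length_sort] at hi
  exact ⟨i, hi, by rw [nthLargest_eq_getElem S hi, h]⟩

theorem nthLargest_lt (S : Finset ℝ) {i j : ℕ} (hij : i < j) (hj : j < S.card) :
    nthLargest S j < nthLargest S i := by
  rw [nthLargest_eq_getElem S hj, nthLargest_eq_getElem S (hij.trans hj)]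
  refine lt_of_le_of_ne
    (List.pairwise_iff_getElem.mp (S.pairwise_sort fun a b : ℝ => b ≤ a) i j _ _ hij) fun h => ?_
  have := (List.Nodup.getElem_inj_iff (S.sort_nodup fun a b : ℝ => b ≤ a)).mp h
  omega

theorem nthLargest_le (S : Finset ℝ) {i j : ℕ} (hij : i ≤ j) (hj : j < S.card) :
    nthLargest S j ≤ nthLargest S i := by
  rcases hij.eq_or_lt with rfl | h
  · exact le_rfl
  · exact (nthLargest_lt S h hj).le

/-- For a set symmetric under negation, negating and reversing the decreasing list gives a
decreasing list of the same elements, hence the same list. -/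
theorem nthLargest_neg (S : Finset ℝ) (hS : ∀ t ∈ S, -t ∈ S) {i : ℕ} (hi : i < S.card) :
    nthLargest S (S.card - 1 - i) = -nthLargest S i := by
  set L := S.sort fun a b : ℝ => b ≤ a with hL
  have hlen : L.length = S.card := Finset.length_sort _
  have hsort : L.Pairwise fun a b => b ≤ a := S.pairwise_sort _
  have hperm : (L.map Neg.neg).reverse.Perm L := by
    refine (List.reverse_perm _).trans ?_
    rw [List.perm_ext_iff_of_nodup ((S.sort_nodup _).map neg_injective) (S.sort_nodup _)]
    intro t
    simp only [List.mem_map, Finset.mem_sort]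
    exact ⟨fun ⟨s, hs, h⟩ => h ▸ hS s hs, fun ht => ⟨-t, hS t ht, neg_neg t⟩⟩
  have heq : (L.map Neg.neg).reverse = L := by
    refine hperm.eq_of_pairwise (fun a b _ _ h1 h2 => le_antisymm h2 h1) ?_ hsort
    rw [List.pairwise_reverse, List.pairwise_map]
    exact hsort.imp fun h => neg_le_neg h
  have hi' : S.card - 1 - i < S.card := by omega
  have key : L[S.card - 1 - i]'(by omega) = -L[i]'(by omega) := by
    have : L[S.card - 1 - i]'(by omega) =
        (L.map Neg.neg).reverse[S.card - 1 - i]'(by simp; omega) := by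
      simp only [heq]
    rw [this, List.getElem_reverse, List.getElem_map]
    congr 2
    simp only [List.length_map]
    omega
  rw [nthLargest_eq_getElem S hi, nthLargest_eq_getElem S hi']
  exact key

end SortedList

/-! ### The spectrum of the adjacency matrix -/

theorem adjMatrix_isHermitian {X : Type*} {Γ : SimpleGraph X} [DecidableRel Γ.Adj] :
    (Γ.adjMatrix ℂ).IsHermitian := by
  ext y z
  simp [Γ.adj_comm]

variable {X : Type*} [Fintype X] [DecidableEq X] {Γ : SimpleGraph X} [DecidableRel Γ.Adj]
  {D k : ℕ} {p : ℕ → ℕ → ℕ → ℕ}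

/-- The finite set of eigenvalues of the adjacency matrix. -/
def specSet (Γ : SimpleGraph X) [DecidableRel Γ.Adj] : Finset ℝ := (finite_eigenvalues Γ).toFinset

theorem eigenvalue_eq_nthLargest (i : ℕ) : eigenvalue Γ i = nthLargest (specSet Γ) i := rfl

theorem mem_specSet_iff {t : ℝ} :
    t ∈ specSet Γ ↔ ∃ w : X → ℂ, w ≠ 0 ∧ (Γ.adjMatrix ℂ).mulVec w = (t : ℂ) • w := by
  rw [specSet, Set.Finite.mem_toFinset, Set.mem_ofPred_eq]
  constructor
  · intro h
    obtain ⟨w, hw⟩ := h.exists_hasEigenvector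
    exact ⟨w, hw.2, by simpa using hw.apply_eq_smul⟩
  · rintro ⟨w, hw, h⟩
    exact Module.End.hasEigenvalue_of_hasEigenvector
      (Module.End.hasEigenvector_iff.mpr ⟨Module.End.mem_eigenspace_iff.mpr (by simpa using h), hw⟩)

theorem mem_specSet_iff_eigenvalues {t : ℝ} :
    t ∈ specSet Γ ↔ ∃ i, (adjMatrix_isHermitian (Γ := Γ)).eigenvalues i = t := by
  rw [specSet, Set.Finite.mem_toFinset, Set.mem_ofPred_eq, Module.End.hasEigenvalue_iff_mem_spectrum,
    Matrix.spectrum_toLin', (adjMatrix_isHermitian (Γ := Γ)).spectrum_eq_image_range]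
  simp

theorem aeval_adjMatrix_eq (q : Polynomial ℂ) :
    Polynomial.aeval (Γ.adjMatrix ℂ) q =
      Unitary.conjStarAlgAut ℂ _ (adjMatrix_isHermitian (Γ := Γ)).eigenvectorUnitary
        (Matrix.diagonal fun i =>
          q.eval ((adjMatrix_isHermitian (Γ := Γ)).eigenvalues i : ℂ)) := by
  conv_lhs => rw [(adjMatrix_isHermitian (Γ := Γ)).spectral_theorem]
  rw [Polynomial.aeval_algHom_apply]
  congr 1
  have h := Polynomial.aeval_algHom_apply (Matrix.diagonalAlgHom (n := X) ℂ (α := ℂ))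
    (RCLike.ofReal ∘ (adjMatrix_isHermitian (Γ := Γ)).eigenvalues) q
  simp only [Matrix.diagonalAlgHom_apply] at h
  rw [h]
  congr 1
  ext i
  rw [Polynomial.aeval_pi_apply]
  simp

theorem trace_aeval_adjMatrix (q : Polynomial ℂ) :
    (Polynomial.aeval (Γ.adjMatrix ℂ) q).trace =
      ∑ i, q.eval ((adjMatrix_isHermitian (Γ := Γ)).eigenvalues i : ℂ) := by
  rw [aeval_adjMatrix_eq, Unitary.conjStarAlgAut_apply, Matrix.trace_mul_cycle,
    Unitary.coe_star_mul_self, one_mul, Matrix.trace_diagonal]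

theorem aeval_adjMatrix_eq_zero {q : Polynomial ℂ} (hq : ∀ t ∈ specSet Γ, q.eval (t : ℂ) = 0) :
    Polynomial.aeval (Γ.adjMatrix ℂ) q = 0 := by
  rw [aeval_adjMatrix_eq, show (fun i => q.eval
    ((adjMatrix_isHermitian (Γ := Γ)).eigenvalues i : ℂ)) = 0 from
      funext fun i => hq _ (mem_specSet_iff_eigenvalues.mpr ⟨i, rfl⟩)]
  simp

theorem aeval_adjMatrix_mulVec {w : X → ℂ} {t : ℂ} (hw : (Γ.adjMatrix ℂ).mulVec w = t • w)
    (q : Polynomial ℂ) : (Polynomial.aeval (Γ.adjMatrix ℂ) q).mulVec w = q.eval t • w := by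
  obtain ⟨r, hr⟩ := Polynomial.X_sub_C_dvd_sub_C_eval (a := t) (p := q)
  have h := congrArg (fun f => (Polynomial.aeval (Γ.adjMatrix ℂ) f).mulVec w) hr
  simp only [mul_comm _ r, map_sub, map_mul, Polynomial.aeval_C, Polynomial.aeval_X,
    Matrix.sub_mulVec, ← Matrix.mulVec_mulVec, Algebra.algebraMap_eq_smul_one,
    Matrix.smul_mulVec, Matrix.one_mulVec, hw, sub_self, Matrix.mulVec_zero] at h
  exact sub_eq_zero.mp h

/-- Changing the sign of an eigenvector on one colour class turns the eigenvalue t into -t. -/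
theorem neg_mem_specSet (hbip : Γ.IsBipartite) {t : ℝ} (ht : t ∈ specSet Γ) : -t ∈ specSet Γ := by
  obtain ⟨C⟩ := exists_coloring_bool hbip
  obtain ⟨w, hw, h⟩ := mem_specSet_iff.mp ht
  refine mem_specSet_iff.mpr ⟨fun y => if C y then w y else - w y, ?_, ?_⟩
  · intro h0
    refine hw (funext fun y => ?_)
    have := congrFun h0 y
    simp only [Pi.zero_apply] at this ⊢
    split_ifs at this
    · exact this
    · simpa using this
  · ext y
    have hy := congrFun h y
    rw [SimpleGraph.adjMatrix_mulVec_apply] at hy ⊢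
    simp only [Pi.smul_apply, smul_eq_mul, Complex.ofReal_neg] at hy ⊢
    rw [Finset.sum_congr rfl (g := fun z => if C y then - w z else w z)]
    · split_ifs
      · rw [Finset.sum_neg_distrib, hy]; ring
      · rw [hy]; ring
    · intro z hz
      have := C.valid ((SimpleGraph.mem_neighborFinset _ _ _).mp hz)
      cases hy : C y <;> cases hz : C z <;> simp_all

theorem degree_mem_specSet [Nonempty X] (hreg : Γ.IsRegularOfDegree k) : (k : ℝ) ∈ specSet Γ := by
  refine mem_specSet_iff.mpr ⟨1, one_ne_zero, ?_⟩
  ext y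
  rw [SimpleGraph.adjMatrix_mulVec_apply]
  simp [hreg.degree_eq y]

/-- Compare both sides of the eigenvector equation at an entry of maximal modulus. -/
theorem abs_le_of_mem_specSet (hreg : Γ.IsRegularOfDegree k) {t : ℝ} (ht : t ∈ specSet Γ) :
    |t| ≤ k := by
  obtain ⟨w, hw, h⟩ := mem_specSet_iff.mp ht
  obtain ⟨y₀, hy₀⟩ := Function.ne_iff.mp hw
  obtain ⟨y, -, hy⟩ := Finset.exists_max_image Finset.univ (fun y => ‖w y‖) ⟨y₀, Finset.mem_univ _⟩
  have hpos : 0 < ‖w y‖ := (norm_pos_iff.mpr hy₀).trans_le (hy y₀ (Finset.mem_univ _))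
  have h1 := congrArg norm (congrFun h y)
  rw [SimpleGraph.adjMatrix_mulVec_apply, Pi.smul_apply, smul_eq_mul, norm_mul,
    Complex.norm_real, Real.norm_eq_abs] at h1
  refine le_of_mul_le_mul_right ?_ hpos
  rw [← h1]
  refine (norm_sum_le _ _).trans ((Finset.sum_le_card_nsmul _ _ ‖w y‖
    fun z _ => hy z (Finset.mem_univ _)).trans ?_)
  rw [SimpleGraph.card_neighborFinset_eq_degree, hreg.degree_eq y, nsmul_eq_mul]

theorem IsDistanceRegularWith.card_specSet (hΓ : IsDistanceRegularWith Γ D p)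
    (hbip : Γ.IsBipartite) (hD : 1 ≤ D) : (specSet Γ).card = D + 1 := by
  classical
  apply le_antisymm
  -- A polynomial in A is determined by its D + 1 values at the distances 0, ..., D, so some nonzero
  -- polynomial of degree at most D + 1 annihilates A; every eigenvalue is one of its roots.
  · choose y z hyz using fun h : Fin (D + 1) => hΓ.exists_dist_eq (Nat.lt_succ_iff.mp h.2)
    let f : Polynomial.degreeLT ℂ (D + 2) →ₗ[ℂ] (Fin (D + 1) → ℂ) :=
      { toFun := fun q h => (Polynomial.aeval (Γ.adjMatrix ℂ) (q : Polynomial ℂ)) (y h) (z h)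
        map_add' := fun q r => by ext; simp
        map_smul' := fun a q => by ext; simp }
    have hfin : Module.finrank ℂ (Polynomial.degreeLT ℂ (D + 2)) = D + 2 := by
      rw [(Polynomial.degreeLTEquiv ℂ (D + 2)).finrank_eq]; simp
    have : FiniteDimensional ℂ (Polynomial.degreeLT ℂ (D + 2)) :=
      FiniteDimensional.of_finrank_pos (by omega)
    have hker : f.ker ≠ ⊥ := LinearMap.ker_ne_bot_of_finrank_lt (by rw [hfin]; simp)
    obtain ⟨⟨q, hqd⟩, hq, hq0⟩ := (Submodule.ne_bot_iff _).mp hker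
    have hq0 : q ≠ 0 := fun h => hq0 (Subtype.ext h)
    have hzero : Polynomial.aeval (Γ.adjMatrix ℂ) q = 0 := by
      obtain ⟨u, hu⟩ := hΓ.exists_aeval_eq_distFun hbip hD q
      ext v w
      have hl : Γ.dist v w < D + 1 := Nat.lt_succ_of_le (hΓ.dist_le v w)
      have h := congrFun (LinearMap.mem_ker.mp hq) ⟨_, hl⟩
      change Polynomial.aeval (Γ.adjMatrix ℂ) q _ _ = 0 at h
      rw [hu, distFun_apply, hyz] at h
      rw [hu]
      exact h
    have hsub : (specSet Γ).map ⟨Complex.ofReal, Complex.ofReal_injective⟩ ⊆ q.roots.toFinset := by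
      intro s hs
      obtain ⟨t, ht, rfl⟩ := Finset.mem_map.mp hs
      obtain ⟨w, hw, h⟩ := mem_specSet_iff.mp ht
      have := aeval_adjMatrix_mulVec h q
      rw [hzero, Matrix.zero_mulVec] at this
      rw [Multiset.mem_toFinset, Polynomial.mem_roots hq0]
      exact (smul_eq_zero.mp this.symm).resolve_right hw
    have h1 := Finset.card_le_card hsub
    rw [Finset.card_map] at h1
    have h2 := Multiset.toFinset_card_le q.roots
    have h3 := Polynomial.card_roots' q
    have h5 : q.natDegree < D + 2 := by
      rw [Polynomial.natDegree_lt_iff_degree_lt hq0]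
      exact Polynomial.mem_degreeLT.mp hqd
    omega
  · by_contra! hlt
    -- This q annihilates A. If its degree were at most D, an entry of q(A) at distance deg q would
    -- receive a contribution from the leading power alone, and that contribution is nonzero.
    set q : Polynomial ℂ := ∏ t ∈ specSet Γ, (Polynomial.X - Polynomial.C (t : ℂ)) with hqdef
    have hmonic : q.Monic := Polynomial.monic_prod_of_monic _ _ fun t _ => Polynomial.monic_X_sub_C _
    have hdeg : q.natDegree = (specSet Γ).card := by
      rw [hqdef, Polynomial.natDegree_prod_of_monic _ _ fun t _ => Polynomial.monic_X_sub_C _]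
      simp
    have hzero := aeval_adjMatrix_eq_zero (Γ := Γ) (q := q) fun t ht => by
      rw [hqdef, Polynomial.eval_prod]
      exact Finset.prod_eq_zero ht (by simp)
    obtain ⟨y, z, hyz⟩ := hΓ.exists_dist_eq (h := (specSet Γ).card) (by omega)
    have h := congrFun (congrFun hzero y) z
    rw [Polynomial.aeval_eq_sum_range, Matrix.sum_apply, Finset.sum_range_succ,
      Finset.sum_eq_zero, zero_add, hmonic.coeff_natDegree, one_smul,
      hΓ.pow_eq_distFun hbip hD, distFun_apply, hyz, hdeg] at h
    · exact hΓ.tridiag_iterate_self _ (by omega) h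
    · intro i hi
      rw [Finset.mem_range, hdeg] at hi
      rw [Matrix.smul_apply, hΓ.pow_eq_distFun hbip hD, distFun_apply, hyz,
        tridiag_iterate_of_lt _ _ hi, smul_zero]

/-- This is the trace of (A² - b_2)(k² - A²), which already has zero diagonal: the diagonal entries
of A² are k, and those of A⁴ are k² + c_2 k(k-1) with c_2 = k - b_2. -/
theorem IsDistanceRegularWith.sum_eigenvalues_eq_zero (hΓ : IsDistanceRegularWith Γ D p)
    (hbip : Γ.IsBipartite) (hD : 3 ≤ D) (hreg : Γ.IsRegularOfDegree k) :
    ∑ i, ((adjMatrix_isHermitian (Γ := Γ)).eigenvalues i ^ 2 - (bNum p 2 : ℝ)) *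
      ((k : ℝ) ^ 2 - (adjMatrix_isHermitian (Γ := Γ)).eigenvalues i ^ 2) = 0 := by
  have h0 := hΓ.downNum_add_upNum hbip (by omega) hreg (h := 0) (by omega)
  have h1 := hΓ.downNum_add_upNum hbip (by omega) hreg (h := 1) (by omega)
  have h2 := hΓ.downNum_add_upNum hbip (by omega) hreg (h := 2) (by omega)
  have hd0 : downNum p 0 = 0 := by simp [downNum]
  have hd1 := hΓ.downNum_one (by omega)
  rw [hd1] at h1
  rw [hd0, zero_add] at h0
  have hb2 : upNum D p 2 = bNum p 2 := by simp [upNum]; omega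
  rw [hb2] at h2
  have h1' : (upNum D p 1 : ℂ) = k - 1 := by rw [← h1]; push_cast; ring
  have h2' : (bNum p 2 : ℂ) = k - downNum p 2 := by rw [← h2]; push_cast; ring
  have key := trace_aeval_adjMatrix (Γ := Γ)
    (((k : ℂ) ^ 2 + bNum p 2) • Polynomial.X ^ 2 - Polynomial.X ^ 4 -
      ((bNum p 2 : ℂ) * k ^ 2) • 1)
  rw [Matrix.trace, Finset.sum_eq_zero] at key
  · have : ((∑ i, ((adjMatrix_isHermitian (Γ := Γ)).eigenvalues i ^ 2 - (bNum p 2 : ℝ)) *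
      ((k : ℝ) ^ 2 - (adjMatrix_isHermitian (Γ := Γ)).eigenvalues i ^ 2) : ℝ) : ℂ) = 0 := by
      rw [key]
      push_cast
      refine Finset.sum_congr rfl fun i _ => ?_
      simp only [Polynomial.eval_sub, Polynomial.eval_smul, Polynomial.eval_one,
        Polynomial.eval_pow, Polynomial.eval_X, smul_eq_mul]
      ring
    exact_mod_cast this
  · intro y _
    simp only [Matrix.diag_apply, map_sub, map_smul, map_pow, map_one, Polynomial.aeval_X,
      Matrix.sub_apply, Matrix.smul_apply, Matrix.one_apply_eq,
      hΓ.pow_eq_distFun hbip (by omega : 1 ≤ D), distFun_apply, SimpleGraph.dist_self]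
    simp [tridiag, h0, h1', h2', hd0, hd1]
    ring

/-- The eigenvalues `θ` of a bipartite distance-regular graph to which the theorem applies. -/
theorem IsDistanceRegularWith.eigenvalue_spec (hΓ : IsDistanceRegularWith Γ D p)
    (hbip : Γ.IsBipartite) (hD : 4 ≤ D) (hreg : Γ.IsRegularOfDegree k) {n : ℕ}
    (hn : n = 1 ∨ (Odd D ∧ n = D / 2)) :
    eigenvalue Γ n ∈ specSet Γ ∧ eigenvalue Γ n ≠ 0 ∧ eigenvalue Γ n ^ 2 ≠ (k : ℝ) ^ 2 ∧
      eigenvalue Γ n ^ 2 ≠ (bNum p 2 : ℝ) := by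
  have := hΓ.connected.nonempty
  rw [eigenvalue_eq_nthLargest]
  set S := specSet Γ with hSdef
  have hcard : S.card = D + 1 := hΓ.card_specSet hbip (by omega)
  have hneg : ∀ i ≤ D, nthLargest S (D - i) = -nthLargest S i := fun i hi => by
    have := nthLargest_neg S (fun t ht => neg_mem_specSet hbip ht) (i := i) (by omega)
    rwa [hcard] at this
  have habs : ∀ t ∈ S, t ^ 2 ≤ (k : ℝ) ^ 2 := fun t ht =>
    sq_le_sq' (neg_le_of_abs_le (abs_le_of_mem_specSet hreg ht))
      (le_of_abs_le (abs_le_of_mem_specSet hreg ht))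
  have hn1 : 1 ≤ n := by rcases hn with h | ⟨_, h⟩ <;> omega
  -- In the case n = d this needs D odd. It gives θ_n > θ_{D-n} = -θ_n, so θ_n is positive.
  have hnD : 2 * n < D := by
    rcases hn with h | ⟨⟨m, hm⟩, h⟩ <;> omega
  have hpos : 0 < nthLargest S n := by
    have h1 := nthLargest_lt S (i := n) (j := D - n) (by omega) (by omega)
    rw [hneg n (by omega)] at h1
    linarith
  have hmem : nthLargest S n ∈ S := nthLargest_mem S (by omega)
  have h0k : nthLargest S 0 = k := by
    refine le_antisymm (le_of_abs_le (abs_le_of_mem_specSet hreg (nthLargest_mem S (by omega)))) ?_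
    obtain ⟨i, hi, h⟩ := exists_nthLargest_eq S (degree_mem_specSet hreg)
    rw [← h]
    exact nthLargest_le S (Nat.zero_le i) hi
  have hltk : nthLargest S n < k := h0k ▸ nthLargest_lt S (by omega) (by omega)
  refine ⟨hmem, hpos.ne', (pow_lt_pow_left₀ hltk hpos.le two_ne_zero).ne, fun hb => ?_⟩
  have hsum := hΓ.sum_eigenvalues_eq_zero hbip (by omega) hreg
  -- If θ_n² = b_2, the summands of the trace identity share a sign: for n = 1 every eigenvalue
  -- other than ±k has modulus at most θ_1, and for n = d with D odd no eigenvalue has modulus below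
  -- θ_d. A vanishing sum then forces each summand to vanish.
  have hall : ∀ t ∈ S, (t ^ 2 - (bNum p 2 : ℝ)) * ((k : ℝ) ^ 2 - t ^ 2) = 0 := by
    rcases hn with rfl | ⟨⟨m, hm⟩, hnd⟩
    · have hle : ∀ t ∈ S, (t ^ 2 - (bNum p 2 : ℝ)) * ((k : ℝ) ^ 2 - t ^ 2) ≤ 0 := by
        intro t ht
        obtain ⟨i, hi, rfl⟩ := exists_nthLargest_eq S ht
        rcases Nat.eq_zero_or_pos i with rfl | hi0
        · rw [h0k]; simp
        rcases (Nat.lt_succ_iff.mp (hcard ▸ hi)).eq_or_lt with rfl | hiD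
        · rw [← Nat.sub_zero i, hneg 0 (by omega), h0k]; simp
        refine mul_nonpos_of_nonpos_of_nonneg ?_ (sub_nonneg.mpr (habs _ ht))
        rw [← hb, sub_nonpos]
        have h1 := nthLargest_le S (i := 1) (j := i) hi0 hi
        have h2 := nthLargest_le S (i := i) (j := D - 1) (by omega) (by omega)
        rw [hneg 1 (by omega)] at h2
        exact sq_le_sq' h2 h1
      have hz := (Finset.sum_eq_zero_iff_of_nonpos
        fun i _ => hle _ (mem_specSet_iff_eigenvalues.mpr ⟨i, rfl⟩)).mp hsum
      intro t ht
      obtain ⟨i, rfl⟩ := mem_specSet_iff_eigenvalues.mp ht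
      exact hz i (Finset.mem_univ i)
    · have hle : ∀ t ∈ S, 0 ≤ (t ^ 2 - (bNum p 2 : ℝ)) * ((k : ℝ) ^ 2 - t ^ 2) := by
        intro t ht
        refine mul_nonneg ?_ (sub_nonneg.mpr (habs _ ht))
        rw [← hb, sub_nonneg]
        obtain ⟨i, hi, rfl⟩ := exists_nthLargest_eq S ht
        rcases le_or_gt i n with hin | hin
        · exact pow_le_pow_left₀ hpos.le (nthLargest_le S hin (by omega)) 2
        · have h1 := nthLargest_le S (i := D - n) (j := i) (by omega) hi
          rw [hneg n (by omega)] at h1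
          rw [← neg_sq (nthLargest S i)]
          exact pow_le_pow_left₀ hpos.le (by linarith) 2
      have hz := (Finset.sum_eq_zero_iff_of_nonneg
        fun i _ => hle _ (mem_specSet_iff_eigenvalues.mpr ⟨i, rfl⟩)).mp hsum
      intro t ht
      obtain ⟨i, rfl⟩ := mem_specSet_iff_eigenvalues.mp ht
      exact hz i (Finset.mem_univ i)
  have hsub : S ⊆ {(k : ℝ), -(k : ℝ), nthLargest S n, -nthLargest S n} := by
    intro t ht
    simp only [Finset.mem_insert, Finset.mem_singleton]
    rcases mul_eq_zero.mp (hall t ht) with h | h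
    · rw [← hb, sub_eq_zero, sq_eq_sq_iff_eq_or_eq_neg] at h
      tauto
    · rw [sub_eq_zero, eq_comm, sq_eq_sq_iff_eq_or_eq_neg] at h
      tauto
  have := (Finset.card_le_card hsub).trans Finset.card_le_four
  omega

end

section

/-! ### Orthogonal complements in the standard module -/

section Perp

variable {X : Type*} [Fintype X]

/-- The orthogonal complement with respect to the standard Hermitian form. -/
def perp (W : Submodule ℂ (X → ℂ)) : Submodule ℂ (X → ℂ) where
  carrier := {u | ∀ w ∈ W, w ⬝ᵥ star u = 0}
  add_mem' := fun ha hb w hw => by rw [star_add, dotProduct_add, ha w hw, hb w hw, add_zero]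
  zero_mem' := fun w _ => by simp
  smul_mem' := fun c a ha w hw => by rw [star_smul, dotProduct_smul, ha w hw, smul_zero]

open ComplexOrder in
theorem eq_zero_of_dotProduct_star {u : X → ℂ} (h : u ⬝ᵥ star u = 0) : u = 0 :=
  dotProduct_star_self_eq_zero.mp ((dotProduct_comm _ _).trans h)

theorem inf_perp_eq_bot (W : Submodule ℂ (X → ℂ)) : W ⊓ perp W = ⊥ := by
  rw [eq_bot_iff]
  rintro u ⟨h1, h2⟩
  exact (Submodule.mem_bot ℂ).mpr (eq_zero_of_dotProduct_star (h2 u h1))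

theorem sup_perp_eq_top (W : Submodule ℂ (X → ℂ)) : W ⊔ perp W = ⊤ := by
  rw [eq_top_iff]
  intro u _
  -- The decomposition is carried over from the Euclidean space structure on the same vectors.
  set e := WithLp.linearEquiv 2 ℂ (X → ℂ)
  set W' : Submodule ℂ (EuclideanSpace ℂ X) := W.comap e.toLinearMap
  obtain ⟨a, ha, b, hb, hab⟩ := Submodule.mem_sup.mp
    ((Submodule.isCompl_orthogonal (K := W')).sup_eq_top ▸ Submodule.mem_top :
      e.symm u ∈ W' ⊔ W'ᗮ)
  refine Submodule.mem_sup.mpr ⟨e a, ha, e b, fun w hw => ?_, ?_⟩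
  · have h := (Submodule.mem_orthogonal' W' b).mp hb (e.symm w) (by simpa [W'] using hw)
    rw [EuclideanSpace.inner_eq_star_dotProduct] at h
    exact h
  · rw [← map_add, hab, LinearEquiv.apply_symm_apply]

theorem mulVec_mem_perp {W : Submodule ℂ (X → ℂ)} {B : Matrix X X ℂ} (hB : B.IsHermitian)
    (hW : ∀ w ∈ W, B.mulVec w ∈ W) {u : X → ℂ} (hu : u ∈ perp W) : B.mulVec u ∈ perp W := by
  intro w hw
  rw [Matrix.star_mulVec, hB.eq, dotProduct_comm, ← Matrix.dotProduct_mulVec, dotProduct_comm]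
  exact hu _ (hW w hw)

/-- The modular law applied to the splitting of the whole space by W'. -/
theorem sup_inf_perp {W W' : Submodule ℂ (X → ℂ)} (hle : W' ≤ W) :
    W' ⊔ (W ⊓ perp W') = W := by
  rw [inf_comm, ← sup_inf_assoc_of_le _ hle, sup_perp_eq_top, top_inf_eq]

end Perp

/-! ### T-modules, complete reducibility, and the space U -/

theorem dualIdem_isHermitian {X : Type*} [DecidableEq X] {Γ : SimpleGraph X} {x : X} (i : ℕ) :
    (dualIdem Γ x i).IsHermitian := by
  refine Matrix.isHermitian_diagonal_of_self_adjoint _ ?_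
  ext y
  by_cases h : Γ.dist x y = i <;> simp [h]

variable {X : Type*} [Fintype X] [DecidableEq X] {Γ : SimpleGraph X}
  {D k : ℕ} {p : ℕ → ℕ → ℕ → ℕ} {x : X}

theorem dualIdem_mulVec_apply (i : ℕ) (w : X → ℂ) (y : X) :
    (dualIdem Γ x i).mulVec w y = if Γ.dist x y = i then w y else 0 := by
  rw [dualIdem, Matrix.mulVec_diagonal]
  split_ifs <;> simp

theorem mem_dualPart {i : ℕ} {W : Submodule ℂ (X → ℂ)} {u : X → ℂ} :
    u ∈ dualPart Γ x i W ↔ ∃ w ∈ W, (dualIdem Γ x i).mulVec w = u := Iff.rfl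

variable [DecidableRel Γ.Adj]

/-- Invariance under a set of generators suffices for being invariant under an adjoined algebra. -/
theorem mulVec_mem_of_mem_adjoin {s : Set (Matrix X X ℂ)} {W : Submodule ℂ (X → ℂ)}
    (hs : ∀ B ∈ s, ∀ w ∈ W, B.mulVec w ∈ W) {B : Matrix X X ℂ} (hB : B ∈ Algebra.adjoin ℂ s) :
    ∀ w ∈ W, B.mulVec w ∈ W := by
  induction hB using Algebra.adjoin_induction with
  | mem B h => exact hs B h
  | algebraMap c =>
    intro w hw
    rw [Algebra.algebraMap_eq_smul_one, Matrix.smul_mulVec, Matrix.one_mulVec]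
    exact W.smul_mem c hw
  | add B C _ _ hB hC =>
    intro w hw
    rw [Matrix.add_mulVec]
    exact W.add_mem (hB w hw) (hC w hw)
  | mul B C _ _ hB hC =>
    intro w hw
    rw [← Matrix.mulVec_mulVec]
    exact hB _ (hC w hw)

theorem isTModule_iff {W : Submodule ℂ (X → ℂ)} :
    IsTModule Γ x W ↔ (∀ w ∈ W, (Γ.adjMatrix ℂ).mulVec w ∈ W) ∧
      ∀ i, ∀ w ∈ W, (dualIdem Γ x i).mulVec w ∈ W := by
  constructor
  · refine fun h => ⟨h _ ?_, fun i => h _ ?_⟩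
    · exact (le_sup_left : boseMesner Γ ≤ terwilliger Γ x) (Algebra.subset_adjoin rfl)
    · exact (le_sup_right : dualBoseMesner Γ x ≤ terwilliger Γ x)
        (Algebra.subset_adjoin ⟨i, rfl⟩)
  · rintro ⟨h1, h2⟩ B hB
    rw [terwilliger, boseMesner, dualBoseMesner, ← Algebra.adjoin_union] at hB
    refine mulVec_mem_of_mem_adjoin ?_ hB
    rintro C (rfl | ⟨i, rfl⟩)
    · exact h1
    · exact h2 i

theorem IsTModule.perp {W : Submodule ℂ (X → ℂ)} (hW : IsTModule Γ x W) :
    IsTModule Γ x (perp W) := by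
  rw [isTModule_iff] at hW ⊢
  exact ⟨fun u hu => mulVec_mem_perp adjMatrix_isHermitian hW.1 hu,
    fun i u hu => mulVec_mem_perp (dualIdem_isHermitian i) (hW.2 i) hu⟩

theorem IsTModule.inf {W W' : Submodule ℂ (X → ℂ)} (hW : IsTModule Γ x W)
    (hW' : IsTModule Γ x W') : IsTModule Γ x (W ⊓ W') :=
  fun B hB w hw => ⟨hW B hB w hw.1, hW' B hB w hw.2⟩

theorem IsTModule.sup {W W' : Submodule ℂ (X → ℂ)} (hW : IsTModule Γ x W)
    (hW' : IsTModule Γ x W') : IsTModule Γ x (W ⊔ W') := by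
  intro B hB w hw
  obtain ⟨a, ha, b, hb, rfl⟩ := Submodule.mem_sup.mp hw
  rw [Matrix.mulVec_add]
  exact add_mem (Submodule.mem_sup_left (hW B hB a ha)) (Submodule.mem_sup_right (hW' B hB b hb))

theorem isTModule_sSup {S : Set (Submodule ℂ (X → ℂ))} (hS : ∀ W ∈ S, IsTModule Γ x W) :
    IsTModule Γ x (sSup S) := by
  intro B hB
  have : sSup S ≤ (sSup S).comap B.mulVecLin :=
    sSup_le fun W hW w hw => (le_sSup hW : W ≤ sSup S) (hS W hW B hB w hw)
  exact fun w hw => this hw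

theorem le_endpointSpan {W : Submodule ℂ (X → ℂ)} {r : ℕ} (hW : IsIrreducibleTModule Γ x W)
    (hr : HasEndpoint Γ x W r) : W ≤ endpointSpan Γ x r :=
  le_sSup ⟨hW, hr⟩

theorem isTModule_endpointSpan (r : ℕ) : IsTModule Γ x (endpointSpan Γ x r) :=
  isTModule_sSup fun _ hW => hW.1.1

/-- A `T`-module with `E_i^* W ≠ 0` contains an irreducible one with the same property. -/
theorem IsTModule.exists_irreducible {W : Submodule ℂ (X → ℂ)} (hW : IsTModule Γ x W) {i : ℕ}
    (hi : dualPart Γ x i W ≠ ⊥) :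
    ∃ W' ≤ W, IsIrreducibleTModule Γ x W' ∧ dualPart Γ x i W' ≠ ⊥ := by
  induction hn : Module.finrank ℂ W using Nat.strong_induction_on generalizing W with
  | _ n ih =>
  by_cases hirr : IsIrreducibleTModule Γ x W
  · exact ⟨W, le_rfl, hirr, hi⟩
  have hne : W ≠ ⊥ := by
    rintro rfl
    exact hi (by simp [dualPart])
  simp only [IsIrreducibleTModule, hW, hne, ne_eq, not_false_eq_true, true_and, not_forall,
    not_or] at hirr
  obtain ⟨W₁, hle, hW₁, hbot, htop⟩ := hirr
  have hsplit := sup_inf_perp hle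
  have hlt₁ : W₁ < W := lt_of_le_of_ne hle htop
  have hlt₂ : W ⊓ DRG.perp W₁ < W := by
    refine lt_of_le_of_ne inf_le_left fun h => hbot ?_
    rw [eq_bot_iff, ← inf_perp_eq_bot W₁]
    exact le_inf le_rfl (hle.trans (inf_eq_left.mp h))
  -- E_i^* W is the sum of the images of the two smaller summands, so at least one of them is
  -- nonzero.
  by_cases h1 : dualPart Γ x i W₁ = ⊥
  · have h2 : dualPart Γ x i (W ⊓ DRG.perp W₁) ≠ ⊥ := by
      intro h2
      rw [← hsplit, dualPart, Submodule.map_sup] at hi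
      exact hi (by rw [← dualPart, ← dualPart, h1, h2, bot_sup_eq])
    obtain ⟨W', h, h'⟩ := ih _ (hn ▸ Submodule.finrank_lt_finrank_of_lt hlt₂) (hW.inf hW₁.perp) h2 rfl
    exact ⟨W', h.trans hlt₂.le, h'⟩
  · obtain ⟨W', h, h'⟩ := ih _ (hn ▸ Submodule.finrank_lt_finrank_of_lt hlt₁) hW₁ h1 rfl
    exact ⟨W', h.trans hle, h'⟩

/-- If E_1^* did not kill the complement of V_0 + Y, that complement would contain an irreducible
module with nonzero E_1^*-part. Its endpoint would be 0 or 1, placing it inside V_0 + Y as well. -/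
theorem dualPart_one_top_le (hD : 1 ≤ Γ.diam) :
    dualPart Γ x 1 ⊤ ≤ endpointSpan Γ x 0 ⊔ endpointSpan Γ x 1 := by
  set P := endpointSpan Γ x 0 ⊔ endpointSpan Γ x 1
  have hP : IsTModule Γ x P := (isTModule_endpointSpan 0).sup (isTModule_endpointSpan 1)
  have hperp : dualPart Γ x 1 (perp P) = ⊥ := by
    by_contra h
    obtain ⟨W, hle, hirr, hW⟩ := hP.perp.exists_irreducible h
    have hWP : W ≤ P := by
      by_cases h0 : dualPart Γ x 0 W = ⊥
      · refine le_trans (le_endpointSpan hirr ⟨⟨hD, hW⟩, ?_⟩) le_sup_right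
        rintro i ⟨-, hi⟩
        by_contra! hlt
        exact hi (Nat.lt_one_iff.mp hlt ▸ h0)
      · exact le_trans (le_endpointSpan hirr ⟨⟨Nat.zero_le _, h0⟩, fun i _ => Nat.zero_le i⟩)
          le_sup_left
    refine hirr.2.1 ?_
    rw [eq_bot_iff, ← inf_perp_eq_bot P]
    exact le_inf hWP hle
  rw [← sup_perp_eq_top P, dualPart, Submodule.map_sup, ← dualPart, ← dualPart, hperp, sup_bot_eq]
  rintro _ ⟨w, hw, rfl⟩
  exact (isTModule_iff.mp hP).2 1 w hw

theorem spaceU_apply_eq_zero {u : X → ℂ} (hu : u ∈ spaceU Γ x) {y : X} (hy : Γ.dist x y ≠ 2) :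
    u y = 0 := by
  obtain ⟨w, -, rfl⟩ := mem_dualPart.mp hu.1
  rw [dualIdem_mulVec_apply, if_neg hy]

/-- The indicator vector of y lies in V_0 + Y, hence so does its image under A. The E_2^*-part of
that image is the indicator of the neighbours of y at distance 2 from x, to which u is orthogonal.
-/
theorem spaceU_sum_neighbors (hD : 1 ≤ Γ.diam) {u : X → ℂ} (hu : u ∈ spaceU Γ x) {y : X}
    (hy : Γ.dist x y = 1) : ∑ z ∈ Γ.neighborFinset y, u z = 0 := by
  have hyP : (Pi.single y 1 : X → ℂ) ∈ endpointSpan Γ x 0 ⊔ endpointSpan Γ x 1 := by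
    refine dualPart_one_top_le hD (mem_dualPart.mpr ⟨Pi.single y 1, trivial, ?_⟩)
    ext z
    rw [dualIdem_mulVec_apply]
    split_ifs with h
    · rfl
    · rw [Pi.single_eq_of_ne]
      rintro rfl
      exact h hy
  have hAP := (isTModule_iff.mp ((isTModule_endpointSpan (Γ := Γ) (x := x) 0).sup
    (isTModule_endpointSpan 1))).1 _ hyP
  have hmem : (dualIdem Γ x 2).mulVec ((Γ.adjMatrix ℂ).mulVec (Pi.single y 1)) ∈
      dualPart Γ x 2 (endpointSpan Γ x 0) ⊔ dualPart Γ x 2 (endpointSpan Γ x 1) := by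
    rw [dualPart, dualPart, ← Submodule.map_sup]
    exact ⟨_, hAP, rfl⟩
  have h := hu.2 _ hmem
  rw [← star_eq_zero, ← h, SimpleGraph.neighborFinset_eq_filter, Finset.sum_filter, star_sum,
    dotProduct]
  refine Finset.sum_congr rfl fun z _ => ?_
  rw [dualIdem_mulVec_apply, Matrix.mulVec_single_one, Matrix.col_apply,
    SimpleGraph.adjMatrix_apply, Pi.star_apply]
  by_cases hz : Γ.dist x z = 2
  · by_cases hadj : Γ.Adj y z <;> simp [hz, hadj, Γ.adj_comm z y]
  · simp [spaceU_apply_eq_zero hu hz]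

end

/-! ### Cosine sequences, and vectors annihilated by a primitive idempotent -/

section

variable {X : Type*} [Fintype X] [DecidableEq X] {Γ : SimpleGraph X} [DecidableRel Γ.Adj]
  {D k : ℕ} {p : ℕ → ℕ → ℕ → ℕ} {x : X}

/-- `e` is, up to a scalar, the cosine sequence of the eigenvalue `θ`. -/
def IsCosineSeq (D : ℕ) (p : ℕ → ℕ → ℕ → ℕ) (θ : ℂ) (e : ℕ → ℂ) : Prop :=
  e 0 ≠ 0 ∧ ∀ h ≤ D, tridiag D p e h = θ * e h

theorem IsDistanceRegularWith.eq_zero_of_tridiag (hΓ : IsDistanceRegularWith Γ D p) {θ : ℂ}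
    {e : ℕ → ℂ} (h0 : e 0 = 0) (he : ∀ h ≤ D, tridiag D p e h = θ * e h) :
    ∀ h ≤ D, e h = 0 := by
  intro h
  induction h using Nat.strong_induction_on with
  | _ h ih =>
  intro hh
  rcases h with _ | h
  · exact h0
  have h1 := he h (by omega)
  have h2 : (downNum p h : ℂ) * e (h - 1) = 0 := by
    rw [ih (h - 1) (by omega) (by omega), mul_zero]
  rw [tridiag, ih h (by omega) (by omega), h2, zero_add, mul_zero] at h1
  exact (mul_eq_zero.mp h1).resolve_left (by exact_mod_cast (hΓ.upNum_pos hh).ne')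

/-- The recurrence can be run downwards because the c_h are nonzero: two consecutive zeros would
propagate to `e 0`. -/
theorem IsCosineSeq.not_consecutive_zero (hΓ : IsDistanceRegularWith Γ D p) {θ : ℂ} {e : ℕ → ℂ}
    (he : IsCosineSeq D p θ e) {h : ℕ} (hh : h + 1 ≤ D) (h0 : e h = 0) : e (h + 1) ≠ 0 := by
  induction h with
  | zero => exact absurd h0 he.1
  | succ h ih =>
    intro h1
    refine ih (by omega) ?_ h0
    have h2 := he.2 (h + 1) (by omega)
    rw [tridiag, h1, h0, mul_zero, mul_zero, add_zero, Nat.add_sub_cancel] at h2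
    exact (mul_eq_zero.mp h2).resolve_left (by exact_mod_cast (hΓ.downNum_pos (by omega)).ne')

/-- With a common value t at m, m+2, m+4, the recurrences at m+1 and m+3 give θ e_{m+1} = θ e_{m+3}
= k t, and the one at m+2 then gives k² t = θ² t. So t = 0 and e_{m+1} = 0, two consecutive zeros.
-/
theorem IsCosineSeq.not_eq_three (hΓ : IsDistanceRegularWith Γ D p) (hbip : Γ.IsBipartite)
    (hreg : Γ.IsRegularOfDegree k) {θ : ℂ} {e : ℕ → ℂ}
    (he : IsCosineSeq D p θ e) (hθ : θ ≠ 0) (hθk : θ ^ 2 ≠ (k : ℂ) ^ 2) {m : ℕ}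
    (hm : m + 4 ≤ D) (h1 : e m = e (m + 4)) : e (m + 2) ≠ e (m + 4) := by
  intro h2
  have hk : ∀ h ≤ D, (downNum p h : ℂ) + upNum D p h = k := fun h hh => by
    exact_mod_cast hΓ.downNum_add_upNum hbip (by omega) hreg hh
  have r1 := he.2 (m + 1) (by omega)
  have r2 := he.2 (m + 2) (by omega)
  have r3 := he.2 (m + 3) (by omega)
  have s1 := hk (m + 1) (by omega)
  have s2 := hk (m + 2) (by omega)
  have s3 := hk (m + 3) (by omega)
  simp only [tridiag, Nat.add_succ_sub_one, Nat.add_assoc, Nat.reduceAdd, add_zero, h1, h2] at r1 r2 r3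
  have hz : e (m + 4) = 0 := by
    refine (mul_eq_zero.mp ?_).resolve_left (sub_ne_zero.mpr hθk)
    linear_combination (-θ) * r2 + (-(downNum p (m + 2) : ℂ)) * r1 +
      (-(upNum D p (m + 2) : ℂ)) * r3 + (downNum p (m + 2) : ℂ) * e (m + 4) * s1 +
      (upNum D p (m + 2) : ℂ) * e (m + 4) * s3 + k * e (m + 4) * s2
  rw [hz, mul_zero, mul_zero, add_zero] at r1
  have hz1 : e (m + 1) = 0 := (mul_eq_zero.mp r1.symm).resolve_left hθ
  exact he.not_consecutive_zero hΓ (h := m + 1) (by omega) hz1 (h2.trans hz)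

theorem IsCosineSeq.local_relation (hΓ : IsDistanceRegularWith Γ D p) (hbip : Γ.IsBipartite)
    (hD : 4 ≤ D) (hreg : Γ.IsRegularOfDegree k) {θ : ℝ} {e : ℕ → ℂ}
    (he : IsCosineSeq D p θ e) (hb : θ ^ 2 ≠ (bNum p 2 : ℝ)) :
    e 0 + (tilde p θ : ℂ) * e 2 - (1 + (tilde p θ : ℂ)) * e 4 = 0 := by
  have hk : ∀ h ≤ D, (downNum p h : ℂ) + upNum D p h = k := fun h hh => by
    exact_mod_cast hΓ.downNum_add_upNum hbip (by omega) hreg hh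
  have r0 := he.2 0 (by omega)
  have r1 := he.2 1 (by omega)
  have r2 := he.2 2 (by omega)
  have r3 := he.2 3 (by omega)
  have s0 := hk 0 (by omega)
  have s1 := hk 1 (by omega)
  have s2 := hk 2 (by omega)
  have s3 := hk 3 (by omega)
  have hd0 : downNum p 0 = 0 := by simp [downNum]
  simp only [tridiag, hΓ.downNum_one (by omega), hd0, Nat.cast_zero, Nat.cast_one, zero_mul,
    one_mul, zero_add, Nat.reduceAdd, Nat.reduceSub] at r0 r1 r2 r3 s0 s1 s2 s3
  have hb2 : upNum D p 2 = bNum p 2 := if_pos (by omega)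
  have hb3 : upNum D p 3 = bNum p 3 := if_pos (by omega)
  rw [hb2] at r2 s2
  rw [hb3] at r3 s3
  have hne : (θ : ℂ) ^ 2 - bNum p 2 ≠ 0 := sub_ne_zero.mpr (by exact_mod_cast hb)
  have hη : (tilde p θ : ℂ) * ((θ : ℂ) ^ 2 - bNum p 2) =
      -((θ : ℂ) ^ 2 - bNum p 2) - bNum p 2 * bNum p 3 := by
    simp only [tilde]
    push_cast
    field_simp
  refine (mul_eq_zero.mp ?_).resolve_left hne
  have e0 : (upNum D p 0 : ℂ) = k := s0
  have e1 : (upNum D p 1 : ℂ) = k - 1 := by linear_combination s1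
  have e2 : (downNum p 2 : ℂ) = k - bNum p 2 := by linear_combination s2
  have e3 : (downNum p 3 : ℂ) = k - bNum p 3 := by linear_combination s3
  rw [e0] at r0
  rw [e1] at r1
  rw [e2] at r2
  rw [e3] at r3
  -- After η(θ² - b_2) is replaced by its value, what remains is (θ² - b_2)(e_0 - e_2) = b_2 b_3
  -- (e_2 - e_4), a consequence of the recurrences at 0, 1, 2, 3.
  linear_combination (e 2 - e 4) * hη + (bNum p 2 : ℂ) * r3 + (θ : ℂ) * r2 -
    (bNum p 2 : ℂ) * r1 - (θ : ℂ) * r0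

/-- Up to a scalar, the primitive idempotent of an eigenvalue. -/
theorem IsDistanceRegularWith.exists_cosineSeq (hΓ : IsDistanceRegularWith Γ D p)
    (hbip : Γ.IsBipartite) (hD : 1 ≤ D) {θ : ℝ} (hθ : θ ∈ specSet Γ) :
    ∃ e, IsCosineSeq D p θ e ∧ (distFun Γ e).IsHermitian ∧
      ∃ c : ℂ, distFun Γ e * distFun Γ e = c • distFun Γ e := by
  classical
  -- On the spectrum, q vanishes except at θ. Hence q(A) is q(θ) times the primitive idempotent of
  -- θ, and it is Hermitian because the roots of q are real.
  set q : Polynomial ℂ :=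
    ∏ t ∈ (specSet Γ).erase θ, (Polynomial.X - Polynomial.C (t : ℂ)) with hq
  have heval : ∀ t : ℂ, q.eval t = ∏ s ∈ (specSet Γ).erase θ, (t - s) := fun t => by
    rw [hq, Polynomial.eval_prod]; simp
  have hqθ : q.eval (θ : ℂ) ≠ 0 := by
    rw [heval, Finset.prod_ne_zero_iff]
    intro s hs h
    exact Finset.ne_of_mem_erase hs (by exact_mod_cast (sub_eq_zero.mp h).symm)
  have hq0 : ∀ t ∈ specSet Γ, t ≠ θ → q.eval (t : ℂ) = 0 := fun t ht hne => by
    rw [heval]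
    exact Finset.prod_eq_zero (Finset.mem_erase.mpr ⟨hne, ht⟩) (sub_self _)
  obtain ⟨e, he⟩ := hΓ.exists_aeval_eq_distFun hbip hD q
  have hA : Γ.adjMatrix ℂ * distFun Γ e = (θ : ℂ) • distFun Γ e := by
    have h := aeval_adjMatrix_eq_zero (Γ := Γ) (q := Polynomial.X * q - (θ : ℂ) • q)
      fun t ht => by
        by_cases h : t = θ
        · simp [h]
        · simp [hq0 t ht h]
    rw [map_sub, map_mul, map_smul, Polynomial.aeval_X, he] at h
    exact sub_eq_zero.mp h
  have hrec : ∀ h ≤ D, tridiag D p e h = θ * e h := by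
    intro h hh
    obtain ⟨y, z, rfl⟩ := hΓ.exists_dist_eq hh
    rw [hΓ.adj_mul_distFun hbip hD] at hA
    exact congrFun (congrFun hA y) z
  refine ⟨e, ⟨fun h0 => ?_, hrec⟩, ?_, q.eval (θ : ℂ), ?_⟩
  · obtain ⟨w, hw, h⟩ := mem_specSet_iff.mp hθ
    have h1 := aeval_adjMatrix_mulVec h q
    have h2 : distFun Γ e = 0 := by
      ext y z
      exact hΓ.eq_zero_of_tridiag h0 hrec _ (hΓ.dist_le y z)
    rw [he, h2, Matrix.zero_mulVec] at h1
    exact hw ((smul_eq_zero.mp h1.symm).resolve_left hqθ)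
  · rw [← he, aeval_adjMatrix_eq, Matrix.IsHermitian, ← Matrix.star_eq_conjTranspose, ← map_star]
    congr 1
    rw [Matrix.star_eq_conjTranspose, Matrix.diagonal_conjTranspose]
    congr 1
    ext i
    rw [Pi.star_apply, heval, star_prod]
    simp
  · have h := aeval_adjMatrix_eq_zero (Γ := Γ) (q := q * q - q.eval (θ : ℂ) • q) fun t ht => by
      by_cases h : t = θ
      · simp [h]
      · simp [hq0 t ht h]
    rw [map_sub, map_mul, map_smul, he] at h
    exact sub_eq_zero.mp h

/-- `v` is supported on the second subconstituent of `x`, and the entries of `v` have sum zero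
over the neighbours of each neighbour of `x`. -/
structure IsLocalVec (Γ : SimpleGraph X) [DecidableRel Γ.Adj] (x : X) (v : X → ℂ) : Prop where
  eq_zero : ∀ y, Γ.dist x y ≠ 2 → v y = 0
  sum_neighbors : ∀ y, Γ.dist x y = 1 → ∑ z ∈ Γ.neighborFinset y, v z = 0

theorem isLocalVec_of_mem_spaceU (hD : 1 ≤ Γ.diam) {v : X → ℂ} (hv : v ∈ spaceU Γ x) :
    IsLocalVec Γ x v :=
  ⟨fun _ => spaceU_apply_eq_zero hv, fun _ => spaceU_sum_neighbors hD hv⟩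

theorem IsLocalVec.distFun_mulVec_self {v : X → ℂ} (hv : IsLocalVec Γ x v) (u : ℕ → ℂ) :
    (distFun Γ u).mulVec v x = u 2 * ∑ z, v z := by
  rw [Matrix.mulVec, dotProduct, Finset.mul_sum]
  refine Finset.sum_congr rfl fun z _ => ?_
  by_cases hz : Γ.dist x z = 2
  · rw [distFun_apply, hz]
  · rw [hv.eq_zero z hz, mul_zero, mul_zero]

/-- The entry of A²v at x is a sum of the vanishing neighbourhood sums, and also the total of v
times the nonzero entry of A² at distance 2. -/
theorem IsLocalVec.sum_eq_zero (hΓ : IsDistanceRegularWith Γ D p) (hbip : Γ.IsBipartite)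
    (hD : 2 ≤ D) {v : X → ℂ} (hv : IsLocalVec Γ x v) : ∑ z, v z = 0 := by
  have h1 : ((Γ.adjMatrix ℂ) ^ 2).mulVec v x = 0 := by
    rw [pow_two, ← Matrix.mulVec_mulVec, SimpleGraph.adjMatrix_mulVec_apply]
    refine Finset.sum_eq_zero fun y hy => ?_
    rw [SimpleGraph.adjMatrix_mulVec_apply]
    exact hv.sum_neighbors y
      (SimpleGraph.dist_eq_one_iff_adj.mpr ((SimpleGraph.mem_neighborFinset _ _ _).mp hy))
  rw [hΓ.pow_eq_distFun hbip (by omega), hv.distFun_mulVec_self] at h1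
  exact (mul_eq_zero.mp h1).resolve_left (hΓ.tridiag_iterate_self 2 hD)

/-- A vertex at distance 2 from x is at distance i-2, i or i+2 from y. The bound `1 ≤ i` keeps
truncated subtraction from identifying i-2 with i; for i = 1 the first term is harmless, as v
vanishes at y. -/
theorem IsLocalVec.distFun_mulVec_apply (hΓ : IsDistanceRegularWith Γ D p) (hbip : Γ.IsBipartite)
    {v : X → ℂ} (hv : IsLocalVec Γ x v) (u : ℕ → ℂ) {y : X} {i : ℕ} (hi : 1 ≤ i)
    (hy : Γ.dist x y = i) :
    (distFun Γ u).mulVec v y = u (i - 2) * (distMatrix Γ (i - 2)).mulVec v y +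
      u i * (distMatrix Γ i).mulVec v y + u (i + 2) * (distMatrix Γ (i + 2)).mulVec v y := by
  simp only [Matrix.mulVec, dotProduct, Finset.mul_sum, ← Finset.sum_add_distrib]
  refine Finset.sum_congr rfl fun z _ => ?_
  by_cases hz : Γ.dist x z = 2
  · have h1 := even_dist_add hΓ.connected hbip x y z
    have h2 := hΓ.connected.dist_triangle (u := x) (v := y) (w := z)
    have h3 := hΓ.connected.dist_triangle (u := x) (v := z) (w := y)
    have h4 := hΓ.connected.dist_triangle (u := y) (v := x) (w := z)
    rw [Γ.dist_comm (u := y) (v := x)] at h4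
    rw [Γ.dist_comm (u := z) (v := y)] at h3
    rw [hy, hz] at h1 h2 h3 h4
    rw [Nat.even_iff] at h1
    simp only [distFun_apply, distMatrix, Matrix.of_apply]
    have hcases : Γ.dist y z = i - 2 ∨ Γ.dist y z = i ∨ Γ.dist y z = i + 2 := by omega
    rcases hcases with h | h | h <;> rw [h]
    · rw [if_pos rfl, if_neg (by omega), if_neg (by omega)]; ring
    · rw [if_pos rfl, if_neg (by omega), if_neg (by omega)]; ring
    · rw [if_pos rfl, if_neg (by omega), if_neg (by omega)]; ring
  · simp [hv.eq_zero z hz]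

theorem IsLocalVec.sum_three_eq_zero (hΓ : IsDistanceRegularWith Γ D p) (hbip : Γ.IsBipartite)
    (hD : 2 ≤ D) {v : X → ℂ} (hv : IsLocalVec Γ x v) {y : X} {i : ℕ} (hi : 1 ≤ i)
    (hy : Γ.dist x y = i) :
    (distMatrix Γ (i - 2)).mulVec v y + (distMatrix Γ i).mulVec v y +
      (distMatrix Γ (i + 2)).mulVec v y = 0 := by
  have h := hv.distFun_mulVec_apply hΓ hbip (fun _ => 1) hi hy
  simp only [one_mul] at h
  rw [← h, Matrix.mulVec, dotProduct]
  simpa using hv.sum_eq_zero hΓ hbip hD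

theorem IsDistanceRegularWith.distMatrix_zero_mulVec (hΓ : IsDistanceRegularWith Γ D p)
    (v : X → ℂ) : (distMatrix Γ 0).mulVec v = v := by
  rw [show distMatrix Γ 0 = 1 by
    ext y z
    simp [distMatrix, Matrix.one_apply, hΓ.connected.dist_eq_zero_iff], Matrix.one_mulVec]

theorem IsDistanceRegularWith.distMatrix_mulVec_of_lt (hΓ : IsDistanceRegularWith Γ D p)
    (v : X → ℂ) {i : ℕ} (hi : D < i) : (distMatrix Γ i).mulVec v = 0 := by
  rw [show distMatrix Γ i = 0 by
    ext y z
    have := hΓ.dist_le y z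
    simp only [distMatrix, Matrix.of_apply, Matrix.zero_apply]
    rw [if_neg (by omega)], Matrix.zero_mulVec]

/-- Only the distances 1 and 3 occur: the sum over distance 1 vanishes by the local condition, and
then so does the one over distance 3, since the total is zero. -/
theorem IsLocalVec.distFun_mulVec_apply_of_dist_one (hΓ : IsDistanceRegularWith Γ D p)
    (hbip : Γ.IsBipartite) (hD : 2 ≤ D) {v : X → ℂ} (hv : IsLocalVec Γ x v) (u : ℕ → ℂ) {y : X}
    (hy : Γ.dist x y = 1) : (distFun Γ u).mulVec v y = 0 := by
  have h1 : (distMatrix Γ 1).mulVec v y = 0 := by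
    rw [← hv.sum_neighbors y hy, ← SimpleGraph.adjMatrix_mulVec_apply]
    congr 2
    ext a b
    simp [distMatrix, SimpleGraph.adjMatrix_apply, SimpleGraph.dist_eq_one_iff_adj]
  have h2 := hv.sum_three_eq_zero hΓ hbip hD le_rfl hy
  have h3 := hv.distFun_mulVec_apply hΓ hbip u le_rfl hy
  rw [hΓ.distMatrix_zero_mulVec, h1, hv.eq_zero y (by omega), add_zero, zero_add] at h2
  rw [h3, hΓ.distMatrix_zero_mulVec, h1, hv.eq_zero y (by omega), h2]
  ring

/-- On the second subconstituent A_0 v = v and A_2 v = ηv, so the zero total forces A_4 v = -(1+η)v.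
-/
theorem IsLocalVec.distFun_mulVec_apply_of_dist_two (hΓ : IsDistanceRegularWith Γ D p)
    (hbip : Γ.IsBipartite) (hD : 2 ≤ D) {v : X → ℂ} (hv : IsLocalVec Γ x v) {η : ℂ}
    (hη : (localMatrix Γ x).mulVec v = η • v) (u : ℕ → ℂ) {y : X} (hy : Γ.dist x y = 2) :
    (distFun Γ u).mulVec v y = (u 0 + η * u 2 - (1 + η) * u 4) * v y := by
  have hvv : (dualIdem Γ x 2).mulVec v = v := by
    ext z
    rw [dualIdem_mulVec_apply]
    split_ifs with h
    · rfl
    · exact (hv.eq_zero z h).symm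
  have h1 : (distMatrix Γ 2).mulVec v y = η * v y := by
    have := congrFun hη y
    rwa [localMatrix, ← Matrix.mulVec_mulVec, hvv, ← Matrix.mulVec_mulVec, dualIdem_mulVec_apply,
      if_pos hy] at this
  have h2 := hv.sum_three_eq_zero hΓ hbip hD one_le_two hy
  rw [hv.distFun_mulVec_apply hΓ hbip u one_le_two hy]
  simp only [Nat.sub_self, hΓ.distMatrix_zero_mulVec, h1, Nat.reduceAdd] at h2 ⊢
  linear_combination u 4 * h2

theorem IsLocalVec.cosine_mulVec_eq_zero (hΓ : IsDistanceRegularWith Γ D p)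
    (hbip : Γ.IsBipartite) (hD : 2 ≤ D) {v : X → ℂ} (hv : IsLocalVec Γ x v) {η : ℂ}
    (hη : (localMatrix Γ x).mulVec v = η • v) {e : ℕ → ℂ}
    (he : e 0 + η * e 2 - (1 + η) * e 4 = 0) (hherm : (distFun Γ e).IsHermitian) {c : ℂ}
    (hc : distFun Γ e * distFun Γ e = c • distFun Γ e) : (distFun Γ e).mulVec v = 0 := by
  apply eq_zero_of_dotProduct_star
  -- With E the given matrix, ‖Ev‖² is a multiple of ⟨Ev, v⟩. The latter is zero because Ev vanishes
  -- at distance 2 from x and v vanishes elsewhere.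
  rw [Matrix.star_mulVec, hherm.eq, dotProduct_comm, ← Matrix.dotProduct_mulVec,
    Matrix.mulVec_mulVec, hc, Matrix.smul_mulVec, dotProduct_smul, dotProduct,
    Finset.sum_eq_zero, smul_zero]
  intro y _
  by_cases hy : Γ.dist x y = 2
  · rw [hv.distFun_mulVec_apply_of_dist_two hΓ hbip hD hη e hy, he, zero_mul, mul_zero]
  · rw [Pi.star_apply, hv.eq_zero y hy, star_zero, zero_mul]

end

/-! ### The orbit Mv as a thin irreducible T-module -/

section

variable {X : Type*} [Fintype X] [DecidableEq X] {Γ : SimpleGraph X} [DecidableRel Γ.Adj]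
  {D k : ℕ} {p : ℕ → ℕ → ℕ → ℕ} {x : X}

theorem self_mem_boseMesnerOrbit (v : X → ℂ) : v ∈ boseMesnerOrbit Γ v :=
  ⟨1, one_mem _, Matrix.one_mulVec v⟩

theorem adjMatrix_mulVec_mem_boseMesnerOrbit {v w : X → ℂ} (hw : w ∈ boseMesnerOrbit Γ v) :
    (Γ.adjMatrix ℂ).mulVec w ∈ boseMesnerOrbit Γ v := by
  obtain ⟨B, hB, rfl⟩ := hw
  exact ⟨_, mul_mem (Algebra.subset_adjoin rfl) hB, (Matrix.mulVec_mulVec _ _ _).symm⟩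

theorem boseMesnerOrbit_le {v : X → ℂ} {W : Submodule ℂ (X → ℂ)} (hv : v ∈ W)
    (hW : ∀ w ∈ W, (Γ.adjMatrix ℂ).mulVec w ∈ W) : boseMesnerOrbit Γ v ≤ W := by
  rintro _ ⟨B, hB, rfl⟩
  refine mulVec_mem_of_mem_adjoin ?_ hB v hv
  rintro _ rfl
  exact hW

/-- A vector supported on a subconstituent is mapped by the adjacency matrix to the
two adjacent subconstituents. -/
theorem adjMatrix_mulVec_eq_add (hc : Γ.Connected) (hbip : Γ.IsBipartite) {w : X → ℂ} {i : ℕ}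
    (hw : (dualIdem Γ x (i + 1)).mulVec w = w) :
    (Γ.adjMatrix ℂ).mulVec w = (dualIdem Γ x i).mulVec ((Γ.adjMatrix ℂ).mulVec w) +
      (dualIdem Γ x (i + 2)).mulVec ((Γ.adjMatrix ℂ).mulVec w) := by
  ext y
  rw [Pi.add_apply, dualIdem_mulVec_apply, dualIdem_mulVec_apply]
  by_cases h1 : Γ.dist x y = i
  · rw [if_pos h1, if_neg (by omega), add_zero]
  by_cases h2 : Γ.dist x y = i + 2
  · rw [if_neg h1, if_pos h2, zero_add]
  rw [if_neg h1, if_neg h2, add_zero, SimpleGraph.adjMatrix_mulVec_apply]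
  refine Finset.sum_eq_zero fun z hz => ?_
  rw [← hw, dualIdem_mulVec_apply, if_neg]
  have := dist_of_adj hc hbip x ((SimpleGraph.mem_neighborFinset _ _ _).mp hz)
  rw [Γ.dist_comm (u := z), Γ.dist_comm (u := y)] at this
  omega

theorem dualIdem_mulVec_dualIdem_mulVec (i : ℕ) (w : X → ℂ) :
    (dualIdem Γ x i).mulVec ((dualIdem Γ x i).mulVec w) = (dualIdem Γ x i).mulVec w := by
  ext y
  simp only [dualIdem_mulVec_apply]
  split_ifs <;> rfl

theorem dualIdem_mulVec_of_ne {i j : ℕ} (hij : i ≠ j) {w : X → ℂ}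
    (hw : (dualIdem Γ x j).mulVec w = w) : (dualIdem Γ x i).mulVec w = 0 := by
  rw [← hw]
  ext y
  simp only [dualIdem_mulVec_apply, Pi.zero_apply]
  split_ifs with h1 h2
  · exact absurd (h1.symm.trans h2) hij
  · rfl
  · rfl

/-- The sequence $v, E_{r+1}^* A v, E_{r+2}^* A E_{r+1}^* A v, …$ for a vector in $E_r^* V$. -/
def raise (Γ : SimpleGraph X) [DecidableRel Γ.Adj] (x : X) (r : ℕ) (v : X → ℂ) : ℕ → X → ℂ
  | 0 => v
  | m + 1 => (dualIdem Γ x (r + m + 1)).mulVec ((Γ.adjMatrix ℂ).mulVec (raise Γ x r v m))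

theorem dualIdem_mulVec_raise {r : ℕ} {v : X → ℂ} (hv : (dualIdem Γ x r).mulVec v = v) (m : ℕ) :
    (dualIdem Γ x (r + m)).mulVec (raise Γ x r v m) = raise Γ x r v m := by
  cases m with
  | zero => exact hv
  | succ m => exact dualIdem_mulVec_dualIdem_mulVec _ _

/-- If all $E_i^* M v$ have dimension at most one, and $E_i^* M v = 0$ for $i < r$, where
$v ∈ E_r^* V$, then $M v$ is a `T`-module. -/
theorem isTModule_boseMesnerOrbit (hc : Γ.Connected) (hbip : Γ.IsBipartite) {r : ℕ} {v : X → ℂ}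
    (hr : 1 ≤ r) (hv : (dualIdem Γ x r).mulVec v = v)
    (hlow : dualPart Γ x (r - 1) (boseMesnerOrbit Γ v) = ⊥)
    (hthin : ∀ i, ∃ g, dualPart Γ x i (boseMesnerOrbit Γ v) ≤ Submodule.span ℂ {g}) :
    IsTModule Γ x (boseMesnerOrbit Γ v) := by
  set W := boseMesnerOrbit Γ v with hWdef
  set w := raise Γ x r v with hw
  have hsupp : ∀ m, (dualIdem Γ x (r + m)).mulVec (w m) = w m := dualIdem_mulVec_raise hv
  -- Raising gives the component `w (m + 2)`. The lowering component lies with `w m` in a space of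
  -- dimension at most one, so it is a multiple of `w m`; if `w m` is zero, so are all later terms.
  have hstep : ∀ m, w m ∈ W → w (m + 1) ∈ W → ∃ a : ℂ,
      (Γ.adjMatrix ℂ).mulVec (w (m + 1)) = a • w m + w (m + 2) := by
    intro m hm hm1
    have h1 := adjMatrix_mulVec_eq_add (i := r + m) hc hbip (hsupp (m + 1))
    have hmem : (dualIdem Γ x (r + m)).mulVec ((Γ.adjMatrix ℂ).mulVec (w (m + 1))) ∈
        dualPart Γ x (r + m) W := ⟨_, adjMatrix_mulVec_mem_boseMesnerOrbit hm1, rfl⟩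
    have hmem' : w m ∈ dualPart Γ x (r + m) W := ⟨w m, hm, hsupp m⟩
    obtain ⟨g, hg⟩ := hthin (r + m)
    obtain ⟨a, ha⟩ := Submodule.mem_span_singleton.mp (hg hmem)
    obtain ⟨b, hb⟩ := Submodule.mem_span_singleton.mp (hg hmem')
    rw [← ha] at h1
    by_cases hb0 : b = 0
    · have hwm : w m = 0 := by rw [← hb, hb0, zero_smul]
      have hwm1 : w (m + 1) = 0 := by
        rw [hw, raise, ← hw, hwm, Matrix.mulVec_zero, Matrix.mulVec_zero]
      have hwm2 : w (m + 2) = 0 := by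
        rw [hw, raise, ← hw, hwm1, Matrix.mulVec_zero, Matrix.mulVec_zero]
      exact ⟨0, by rw [hwm1, hwm2, Matrix.mulVec_zero, zero_smul, add_zero]⟩
    · refine ⟨a / b, ?_⟩
      rw [h1, ← hb, smul_smul, div_mul_cancel₀ _ hb0]
      rfl
  have hbase : (Γ.adjMatrix ℂ).mulVec (w 0) = w 1 := by
    obtain ⟨s, rfl⟩ : ∃ s, r = s + 1 := ⟨r - 1, by omega⟩
    have h1 := adjMatrix_mulVec_eq_add (i := s) hc hbip (hsupp 0)
    have hmem : (dualIdem Γ x s).mulVec ((Γ.adjMatrix ℂ).mulVec (w 0)) ∈ dualPart Γ x s W :=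
      ⟨_, adjMatrix_mulVec_mem_boseMesnerOrbit (self_mem_boseMesnerOrbit v), rfl⟩
    rw [show dualPart Γ x s W = ⊥ from hlow, Submodule.mem_bot] at hmem
    rw [h1, hmem, zero_add]
    rfl
  have hmem : ∀ m, w m ∈ W ∧ w (m + 1) ∈ W := by
    intro m
    induction m with
    | zero =>
      refine ⟨self_mem_boseMesnerOrbit v, ?_⟩
      rw [zero_add, ← hbase]
      exact adjMatrix_mulVec_mem_boseMesnerOrbit (self_mem_boseMesnerOrbit v)
    | succ m ih =>
      refine ⟨ih.2, ?_⟩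
      obtain ⟨a, ha⟩ := hstep m ih.1 ih.2
      rw [add_assoc, ← sub_eq_iff_eq_add'.mpr ha]
      exact W.sub_mem (adjMatrix_mulVec_mem_boseMesnerOrbit ih.2) (W.smul_mem a ih.1)
  have hspan : ∀ B : Matrix X X ℂ, (∀ m, B.mulVec (w m) ∈ Submodule.span ℂ (Set.range w)) →
      ∀ u ∈ Submodule.span ℂ (Set.range w), B.mulVec u ∈ Submodule.span ℂ (Set.range w) := by
    intro B hB
    have : Submodule.span ℂ (Set.range w) ≤
        (Submodule.span ℂ (Set.range w)).comap B.mulVecLin := by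
      rw [Submodule.span_le]
      rintro _ ⟨m, rfl⟩
      exact hB m
    exact fun u hu => this hu
  have hsub : ∀ m, w m ∈ Submodule.span ℂ (Set.range w) :=
    fun m => Submodule.subset_span ⟨m, rfl⟩
  have hA : ∀ u ∈ Submodule.span ℂ (Set.range w),
      (Γ.adjMatrix ℂ).mulVec u ∈ Submodule.span ℂ (Set.range w) := by
    refine hspan _ fun m => ?_
    rcases m with _ | m
    · rw [hbase]
      exact hsub 1
    · obtain ⟨a, ha⟩ := hstep m (hmem m).1 (hmem m).2
      rw [ha]
      exact add_mem (Submodule.smul_mem _ a (hsub m)) (hsub (m + 2))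
  -- The orbit is thus spanned by vectors each supported on a single subconstituent, which makes it
  -- stable under every E_i^*.
  have hWspan : W = Submodule.span ℂ (Set.range w) := by
    refine le_antisymm (boseMesnerOrbit_le (hsub 0) hA) ?_
    rw [Submodule.span_le]
    rintro _ ⟨m, rfl⟩
    exact (hmem m).1
  rw [hWspan, isTModule_iff]
  refine ⟨hA, fun i => hspan _ fun m => ?_⟩
  by_cases h : i = r + m
  · rw [h, hsupp m]
    exact hsub m
  · rw [dualIdem_mulVec_of_ne h (hsupp m)]
    exact Submodule.zero_mem _

theorem isIrreducibleTModule_boseMesnerOrbit {r : ℕ} {v : X → ℂ} (hv0 : v ≠ 0)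
    (hv : (dualIdem Γ x r).mulVec v = v)
    (hone : dualPart Γ x r (boseMesnerOrbit Γ v) ≤ Submodule.span ℂ {v})
    (hT : IsTModule Γ x (boseMesnerOrbit Γ v)) :
    IsIrreducibleTModule Γ x (boseMesnerOrbit Γ v) := by
  set W := boseMesnerOrbit Γ v
  have hgen : ∀ W', IsTModule Γ x W' → v ∈ W' → W ≤ W' := fun W' hW' hvW' =>
    boseMesnerOrbit_le hvW' (isTModule_iff.mp hW').1
  refine ⟨hT, fun h => hv0 ?_, fun W' hle hW' => ?_⟩
  · have := self_mem_boseMesnerOrbit (Γ := Γ) v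
    rwa [show boseMesnerOrbit Γ v = ⊥ from h, Submodule.mem_bot] at this
  · have hvmem : v ∈ W' ⊔ (W ⊓ perp W') := by
      rw [sup_inf_perp hle]
      exact self_mem_boseMesnerOrbit v
    obtain ⟨a, ha, b, hb, hab⟩ := Submodule.mem_sup.mp hvmem
    have ha' := (isTModule_iff.mp hW').2 r a ha
    have hb' := (isTModule_iff.mp (hT.inf hW'.perp)).2 r b hb
    obtain ⟨c, hc⟩ := Submodule.mem_span_singleton.mp (hone ⟨a, hle ha, rfl⟩)
    simp only [Matrix.mulVecLin_apply] at hc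
    -- Here E_r^* a = c v. If c = 0 then v lies in the complement of `W'`, and so does the whole
    -- orbit; otherwise v lies in `W'`, which is then the whole orbit.
    by_cases hc0 : c = 0
    · left
      have hvb : v = (dualIdem Γ x r).mulVec b := by
        rw [← hv, ← hab, Matrix.mulVec_add, ← hc, hc0, zero_smul, zero_add]
      have hWperp : W ≤ perp W' := hgen _ hW'.perp (hvb ▸ hb'.2)
      rw [eq_bot_iff, ← inf_perp_eq_bot W']
      exact le_inf le_rfl (hle.trans hWperp)
    · right
      refine le_antisymm hle (hgen W' hW' ?_)
      rw [← hc] at ha'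
      exact (Submodule.smul_mem_iff W' hc0).mp ha'

/-- Three functions with two independent linear relations are multiples of a single one. -/
theorem exists_common_multiple {Y : Type*} (P : Y → Prop) {a b c : Y → ℂ} {α β γ : ℂ}
    (hsum : ∀ y, P y → a y + b y + c y = 0)
    (hrel : ∀ y, P y → α * a y + β * b y + γ * c y = 0)
    (hne : (∀ y, P y → c y = 0) ∨ (α = γ → β ≠ γ)) :
    ∃ g : Y → ℂ, ∀ r s t : ℂ, ∃ l : ℂ, ∀ y, P y → r * a y + s * b y + t * c y = l * g y := by
  rcases hne with hc | hne
  · refine ⟨a, fun r s t => ⟨r - s, fun y hy => ?_⟩⟩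
    linear_combination s * hsum y hy + (t - s) * hc y hy
  have hrel' : ∀ y, P y → (α - γ) * a y + (β - γ) * b y = 0 := fun y hy => by
    linear_combination hrel y hy - γ * hsum y hy
  by_cases h : α = γ
  · refine ⟨a, fun r s t => ⟨r - t, fun y hy => ?_⟩⟩
    have h1 := hrel' y hy
    rw [h, sub_self, zero_mul, zero_add] at h1
    have h2 := (mul_eq_zero.mp h1).resolve_left (sub_ne_zero.mpr (hne h))
    linear_combination t * hsum y hy + (s - t) * h2
  · refine ⟨b, fun r s t => ⟨s - t - (r - t) * ((β - γ) / (α - γ)), fun y hy => ?_⟩⟩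
    have h1 : a y = -((β - γ) * b y) / (α - γ) := by
      rw [eq_div_iff (sub_ne_zero.mpr h)]
      linear_combination hrel' y hy
    linear_combination t * hsum y hy + (r - t) * h1

/-- For a local vector annihilated by a suitable `distFun Γ e`, all $E_i^* M v$ have dimension
at most one. -/
theorem IsLocalVec.exists_dualPart_le_span (hΓ : IsDistanceRegularWith Γ D p)
    (hbip : Γ.IsBipartite) (hD : 4 ≤ D) {v : X → ℂ} (hv : IsLocalVec Γ x v) {e : ℕ → ℂ}
    (he : (distFun Γ e).mulVec v = 0)
    (hne : ∀ m, m + 4 ≤ D → e m = e (m + 4) → e (m + 2) ≠ e (m + 4)) (m : ℕ) :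
    ∃ g, dualPart Γ x (m + 2) (boseMesnerOrbit Γ v) ≤ Submodule.span ℂ {g} := by
  have happ : ∀ u y, Γ.dist x y = m + 2 → (distFun Γ u).mulVec v y =
      u m * (distMatrix Γ m).mulVec v y + u (m + 2) * (distMatrix Γ (m + 2)).mulVec v y +
        u (m + 4) * (distMatrix Γ (m + 4)).mulVec v y := fun u y hy =>
    hv.distFun_mulVec_apply hΓ hbip u (i := m + 2) (by omega) hy
  have hsum : ∀ y, Γ.dist x y = m + 2 → (distMatrix Γ m).mulVec v y +
      (distMatrix Γ (m + 2)).mulVec v y + (distMatrix Γ (m + 4)).mulVec v y = 0 := fun y hy =>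
    hv.sum_three_eq_zero hΓ hbip (i := m + 2) (by omega) (by omega) hy
  obtain ⟨g, hg⟩ := exists_common_multiple (fun y => Γ.dist x y = m + 2)
    (a := (distMatrix Γ m).mulVec v) (b := (distMatrix Γ (m + 2)).mulVec v)
    (c := (distMatrix Γ (m + 4)).mulVec v) (α := e m) (β := e (m + 2)) (γ := e (m + 4))
    hsum
    (fun y hy => by rw [← happ e y hy, he, Pi.zero_apply])
    (by
      -- Beyond the diameter the third function is zero, so the zero-sum relation alone suffices.
      by_cases hm : m + 4 ≤ D
      · exact Or.inr (hne m hm)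
      · exact Or.inl fun y _ => congrFun (hΓ.distMatrix_mulVec_of_lt v (not_le.mp hm)) y)
  refine ⟨(dualIdem Γ x (m + 2)).mulVec g, ?_⟩
  rintro _ ⟨_, ⟨B, hB, rfl⟩, rfl⟩
  obtain ⟨q, rfl⟩ := mem_boseMesner_iff.mp hB
  obtain ⟨u, hu⟩ := hΓ.exists_aeval_eq_distFun hbip (by omega) q
  obtain ⟨l, hl⟩ := hg (u m) (u (m + 2)) (u (m + 4))
  refine Submodule.mem_span_singleton.mpr ⟨l, ?_⟩
  ext y
  rw [hu, Matrix.mulVecLin_apply, Pi.smul_apply, dualIdem_mulVec_apply, dualIdem_mulVec_apply]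
  split_ifs with hy
  · rw [happ u y hy, hl y hy, smul_eq_mul]
  · rw [smul_zero]

theorem IsLocalVec.dualPart_eq_bot (hΓ : IsDistanceRegularWith Γ D p)
    (hbip : Γ.IsBipartite) (hD : 2 ≤ D) {v : X → ℂ} (hv : IsLocalVec Γ x v) {i : ℕ} (hi : i < 2) :
    dualPart Γ x i (boseMesnerOrbit Γ v) = ⊥ := by
  rw [eq_bot_iff]
  rintro _ ⟨_, ⟨B, hB, rfl⟩, rfl⟩
  obtain ⟨q, rfl⟩ := mem_boseMesner_iff.mp hB
  obtain ⟨u, hu⟩ := hΓ.exists_aeval_eq_distFun hbip (by omega) q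
  rw [Submodule.mem_bot]
  ext y
  rw [hu, Matrix.mulVecLin_apply, dualIdem_mulVec_apply, Pi.zero_apply]
  split_ifs with hy
  · interval_cases i
    · rw [← hΓ.connected.dist_eq_zero_iff.mp hy, hv.distFun_mulVec_self,
        hv.sum_eq_zero hΓ hbip hD, mul_zero]
    · exact hv.distFun_mulVec_apply_of_dist_one hΓ hbip hD u hy
  · rfl

theorem IsLocalVec.dualPart_two_le_span (hΓ : IsDistanceRegularWith Γ D p)
    (hbip : Γ.IsBipartite) (hD : 2 ≤ D) {v : X → ℂ} (hv : IsLocalVec Γ x v) {η : ℂ}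
    (hη : (localMatrix Γ x).mulVec v = η • v) :
    dualPart Γ x 2 (boseMesnerOrbit Γ v) ≤ Submodule.span ℂ {v} := by
  rintro _ ⟨_, ⟨B, hB, rfl⟩, rfl⟩
  obtain ⟨q, rfl⟩ := mem_boseMesner_iff.mp hB
  obtain ⟨u, hu⟩ := hΓ.exists_aeval_eq_distFun hbip (by omega) q
  refine Submodule.mem_span_singleton.mpr ⟨u 0 + η * u 2 - (1 + η) * u 4, ?_⟩
  ext y
  rw [hu, Matrix.mulVecLin_apply, dualIdem_mulVec_apply, Pi.smul_apply, smul_eq_mul]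
  split_ifs with hy
  · rw [hv.distFun_mulVec_apply_of_dist_two hΓ hbip hD hη u hy]
  · rw [hv.eq_zero y hy, mul_zero]

end

end DRG

end

/-! ### The main theorem -/

theorem mainTheorem5 {X : Type*} [Fintype X] [DecidableEq X]
    (Γ : SimpleGraph X) [DecidableRel Γ.Adj]
    (D k : ℕ) (p : ℕ → ℕ → ℕ → ℕ)
    (hΓ : DRG.IsDistanceRegularWith Γ D p) (hbip : Γ.IsBipartite)
    (hD : 4 ≤ D) (hreg : Γ.IsRegularOfDegree k) (hk : 3 ≤ k)
    (x : X) (n : ℕ) (hn : n = 1 ∨ (Odd D ∧ n = D / 2)) :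
    DRG.eigenvalue Γ n ^ 2 ≠ (DRG.bNum p 2 : ℝ) ∧
    ∀ η : ℝ, η = DRG.tilde p (DRG.eigenvalue Γ n) →
      ∀ v ∈ DRG.spaceUEta Γ x η, v ≠ 0 →
        DRG.IsIrreducibleTModule Γ x (DRG.boseMesnerOrbit Γ v) ∧
        DRG.IsThin Γ x (DRG.boseMesnerOrbit Γ v) ∧
        DRG.HasEndpoint Γ x (DRG.boseMesnerOrbit Γ v) 2 ∧
        DRG.HasLocalEigenvalue Γ x (DRG.boseMesnerOrbit Γ v) η := by
  open DRG in
  obtain ⟨hmem, hθ0, hθk, hθb⟩ := hΓ.eigenvalue_spec hbip hD hreg hn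
  refine ⟨hθb, ?_⟩
  rintro η hη v ⟨hvU, hvη⟩ hv0
  have hdiam := hΓ.diam_eq
  have hv : IsLocalVec Γ x v := isLocalVec_of_mem_spaceU (by omega) hvU
  have hloc : (localMatrix Γ x).mulVec v = (η : ℂ) • v := Module.End.mem_eigenspace_iff.mp hvη
  obtain ⟨e, he, hherm, c, hc⟩ := hΓ.exists_cosineSeq hbip (by omega) hmem
  have hEv := hv.cosine_mulVec_eq_zero hΓ hbip (by omega) hloc
    (hη ▸ he.local_relation hΓ hbip hD hreg hθb) hherm hc
  have hlow : ∀ i < 2, dualPart Γ x i (boseMesnerOrbit Γ v) = ⊥ := fun i hi =>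
    hv.dualPart_eq_bot hΓ hbip (by omega) hi
  have hthin : ∀ i, ∃ g, dualPart Γ x i (boseMesnerOrbit Γ v) ≤ Submodule.span ℂ {g} := by
    intro i
    rcases lt_or_ge i 2 with hi | hi
    · exact ⟨0, (hlow i hi).le.trans bot_le⟩
    · obtain ⟨m, rfl⟩ := Nat.exists_eq_add_of_le' hi
      exact hv.exists_dualPart_le_span hΓ hbip hD hEv (fun m hm =>
        he.not_eq_three hΓ hbip hreg (by exact_mod_cast hθ0) (by exact_mod_cast hθk) hm) m
  have hsupp : (dualIdem Γ x 2).mulVec v = v := by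
    ext y
    rw [dualIdem_mulVec_apply]
    split_ifs with hy
    · rfl
    · exact (hv.eq_zero y hy).symm
  have htwo : dualPart Γ x 2 (boseMesnerOrbit Γ v) = Submodule.span ℂ {v} := by
    refine le_antisymm (hv.dualPart_two_le_span hΓ hbip (by omega) hloc) ?_
    rw [Submodule.span_singleton_le_iff_mem]
    exact ⟨v, self_mem_boseMesnerOrbit v, hsupp⟩
  have hT := isTModule_boseMesnerOrbit hΓ.connected hbip one_le_two hsupp
    (hlow 1 one_lt_two) hthin
  refine ⟨isIrreducibleTModule_boseMesnerOrbit hv0 hsupp htwo.le hT, ?_, ⟨⟨by omega, ?_⟩, ?_⟩,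
    ?_, ?_⟩
  · intro i _
    obtain ⟨g, hg⟩ := hthin i
    exact (Submodule.finrank_mono hg).trans ((finrank_span_le_card _).trans (by simp))
  · rw [htwo, ne_eq, Submodule.span_singleton_eq_bot]
    exact hv0
  · rintro i ⟨-, hi⟩
    by_contra! hlt
    exact hi (hlow i hlt)
  · rw [htwo, finrank_span_singleton hv0]
  · intro w hw
    rw [htwo] at hw
    obtain ⟨a, rfl⟩ := Submodule.mem_span_singleton.mp hw
    rw [Matrix.mulVec_smul, hloc, smul_comm]
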